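/- A literal is a propositional variable or its negation, a clause is a finite set of literals (read as their disjunction) that does not contain two opposite literals, and a formula is a set of clauses. Two clauses $c_1\cup\{l\}$ and $c_2\cup\{\neg l\}$ (with $l\notin c_1$, $\neg l\notin c_2$) resolve to $c_1\cup c_2$, provided that $c_1\cup c_2$ does not contain two opposite literals (otherwise they do not resolve). For a formula $F$, $\mathrm{ResCn}(F)$ is the set of all clauses obtained from the clauses of $F$ by zero or more resolution steps, and $\mathrm{resolve}(F,c)$ is the set of the clauses obtained by resolving, once, a clause of $F$ with the clause $c$. A clause $c\in F$ is superredundant in $F$ if $\mathrm{ResCn}(F)\setminus\{c\}\models c$. A formula is Horn if each of its clauses contains at most one positive literal, and Krom if each of its clauses contains at most two literals. **Theorem.** The following problem is solvable in polynomial time: given a finite Horn formula $F$ and a clause $c\in F$, decide whether $c$ is superredundant in $F$. The same holds for Krom formulae. That is, for each of the two classes there is a deterministic multi-stack Turing machine that answers correctly on all such inputs $(F,c)$, written as words over a finite alphabet in which the variables are named by binary words, within a number of steps bounded by a polynomial in the length of the input. Moreover, for every Horn or Krom formula $F$ and every $c\in F$, $$c \text{ is superredundant in } F \iff (F\setminus\{c\})\cup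 \mathrm{resolve}(F,c)\models c ,$$ and if $F$ is Horn (respectively Krom), then so is $\mathrm{ResCn}(F)$. -/

import Mathlib

namespace Superredundancy

/-- Propositional variables are named by finite binary words. -/
abbrev Variable : Type := List Bool

/-- A literal is a variable with a sign: `(x, true)` is `x` and `(x, false)` is `¬ x`. -/
abbrev Literal : Type := Variable × Bool

/-- The opposite literal. -/
def Literal.opp (l : Literal) : Literal := (l.1, !l.2)

/-- A clause is the disjunction of a finite set of literals. -/
abbrev Clause : Type := Finset Literal

/-- A clause is a tautology if it contains two opposite literals. -/
def Clause.IsTautology (c : Clause) : Prop := ∃ l ∈ c, l.opp ∈ c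

/-- An assignment satisfies a clause if it makes one of its literals true. -/
def Clause.SatisfiedBy (c : Clause) (v : Variable → Bool) : Prop := ∃ l ∈ c, v l.1 = l.2

/-- `F ⊨ c`: every assignment that satisfies all clauses of `F` satisfies `c`. -/
def Entails (F : Set Clause) (c : Clause) : Prop :=
  ∀ v : Variable → Bool, (∀ d ∈ F, d.SatisfiedBy v) → c.SatisfiedBy v

/-- `c` is the result of resolving `c₁` with `c₂`. None of the three may be a tautology: two
clauses that would resolve in a tautology do not resolve. -/
def Resolvent (c₁ c₂ c : Clause) : Prop :=
  ¬ c₁.IsTautology ∧ ¬ c₂.IsTautology ∧ ¬ c.IsTautology ∧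
    ∃ l ∈ c₁, l.opp ∈ c₂ ∧ c = c₁.erase l ∪ c₂.erase l.opp

/-- `F ⊢ c`: the clause `c` is obtained from `F` by zero or more resolution steps. -/
inductive Derives (F : Set Clause) : Clause → Prop
  | mem {c : Clause} : c ∈ F → Derives F c
  | step {c₁ c₂ c : Clause} : Derives F c₁ → Derives F c₂ → Resolvent c₁ c₂ c → Derives F c

/-- The resolution closure of `F`. -/
def ResCn (F : Set Clause) : Set Clause := {c | Derives F c}

/-- The clauses obtained by resolving one clause of `A` with one clause of `B`, once. -/
def resolve (A B : Set Clause) : Set Clause := {c | ∃ c₁ ∈ A, ∃ c₂ ∈ B, Resolvent c₁ c₂ c}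

/-- A clause `c` of `F` is superredundant if it is redundant in the resolution closure of `F`. -/
def Superredundant (F : Set Clause) (c : Clause) : Prop := Entails (ResCn F \ {c}) c

/-- Formulae contain no tautologies. -/
def TautologyFree (F : Set Clause) : Prop := ∀ c ∈ F, ¬ c.IsTautology

/-- A Horn formula: every clause contains at most one positive literal. -/
def IsHorn (F : Set Clause) : Prop :=
  TautologyFree F ∧ ∀ c ∈ F, (c.filter fun l => l.2 = true).card ≤ 1

/-- A Krom formula: every clause contains at most two literals. -/
def IsKrom (F : Set Clause) : Prop := TautologyFree F ∧ ∀ c ∈ F, c.card ≤ 2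

/-- The set of clauses that a list of lists of literals denotes; order and repetitions are
irrelevant. -/
def clausesOf (L : List (List Literal)) : Set Clause := {c | ∃ k ∈ L, k.toFinset = c}

/-- An input of the problem of checking superredundancy in the formulae of the class `C`: a formula
of the class and one of its clauses, written as lists. -/
structure Input (C : Set Clause → Prop) where
  formula : List (List Literal)
  clause : List Literal
  formula_mem : C (clausesOf formula)
  clause_mem : clause.toFinset ∈ clausesOf formula

/-- The alphabet in which inputs are written. -/
inductive Symbol
  | bit (b : Bool)
  | sign (b : Bool)
  | endClause
  deriving DecidableEq, Fintype

/-- A literal is written as its sign followed by the name of its variable. -/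
def encodeLiteral (l : Literal) : List Symbol := Symbol.sign l.2 :: l.1.map Symbol.bit

/-- A clause is written as its literals, one after the other, followed by an end marker. -/
def encodeClause (k : List Literal) : List Symbol := k.flatMap encodeLiteral ++ [Symbol.endClause]

/-- An input is written as the clause to be checked followed by the clauses of the formula. -/
def Input.encode {C : Set Clause → Prop} (p : Input C) : List Symbol :=
  encodeClause p.clause ++ p.formula.flatMap encodeClause

/-- Checking superredundancy in the formulae of the class `C` is polynomial-time: one multi-stack
Turing machine answers correctly on every input, in a number of steps that is bounded by a
polynomial in the length of the written input. -/
def SuperredundancyInPolyTime (C : Set Clause → Prop) : Prop :=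
  ∃ f : Input C → Bool,
    (∀ p, f p = true ↔ Superredundant (clausesOf p.formula) p.clause.toFinset) ∧
      Nonempty (Turing.TM2ComputableInPolyTime Input.encode Computability.encodeBool f)

end Superredundancy

namespace Superredundancy

/-! One-step criterion. Fix an assignment `v` that falsifies `c`. The opposites of the literals of
`c` are then true, and a clause `d` resolves with `c` on `l` into a clause that `v` satisfies
exactly when `v` satisfies `d` without `l.opp`. Call `d` robustly satisfied if `v` satisfies `d`,
and still does so after removal of the opposite of any one literal of `c`. Robustness passes to the
resolvent of two robust clauses, and also to the resolvent of a robust clause with `c` itself: as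
tautologies are banned, that resolvent contains no opposite of a literal of `c`, so there is nothing
to remove. Hence if all clauses of `F` other than `c` are robust, so is everything derivable other
than `c` (`Derives.robustlySatisfied`). On the other hand, robustness of these clauses says no more
than that `v` satisfies `F \ {c}` and `resolve F {c}` (`robustlySatisfied_iff`). This gives
`superredundant_iff`.

Reduction to satisfiability. When `c` is false, a clause is robust if and only if it contains the
opposites of two different literals of `c` or a true literal over a variable outside of `c`. So `c`
is superredundant if and only if no assignment satisfies the parts outside of the variables of `c`
of the active clauses: those that differ from `c` and contain the opposite of at most one literal of
`c` (`superredundant_iff_active`).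

Decision procedure. Unit propagation is run from every literal of the formula and from its opposite;
the answer is yes if for some literal both runs end in a conflict. A satisfying assignment agrees
with one of the two starting literals and then with all that is propagated, so it excludes this
outcome. Conversely, take a run without conflict. In the Horn case, making every variable false that
is not propagated to true satisfies everything. In the Krom case the run yields a partial assignment
that satisfies every active clause it touches; such assignments can be overlaid until all variables
are covered.

Machine. The procedure is written in a small structured language of stack programs with a
step-counting semantics, which is compiled to `Turing.TM2`. It consists of passes over the formula,
each comparing all literals with one current literal and updating marks in place, inside of at most
three nested loops over literals. Marks do not change the length of the stored formula, so the
bounds compose to a polynomial. -/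

@[simp] theorem Literal.opp_opp (l : Literal) : l.opp.opp = l := by
  simp [Literal.opp]

theorem Literal.opp_ne (l : Literal) : l.opp ≠ l := by
  intro h
  have := congrArg Prod.snd h
  simp [Literal.opp] at this

theorem Literal.eq_opp_comm {l m : Literal} : l = m.opp ↔ l.opp = m := by
  constructor
  · rintro rfl; simp
  · rintro rfl; simp

theorem Literal.val_opp {v : Variable → Bool} {l : Literal} : v l.opp.1 = l.opp.2 ↔ ¬ v l.1 = l.2 := by
  simp only [Literal.opp]
  cases v l.1 <;> cases l.2 <;> simp

theorem Clause.IsTautology.not_mem {c : Clause} (hc : ¬ c.IsTautology) {l : Literal} (hl : l ∈ c) :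
    l.opp ∉ c := fun h => hc ⟨l, hl, h⟩

theorem Resolvent.satisfiedBy {c₁ c₂ c : Clause} (h : Resolvent c₁ c₂ c) {v : Variable → Bool}
    (h₁ : c₁.SatisfiedBy v) (h₂ : c₂.SatisfiedBy v) : c.SatisfiedBy v := by
  obtain ⟨-, -, -, l, hl, hl', rfl⟩ := h
  by_cases hv : v l.1 = l.2
  · obtain ⟨m, hm, hmv⟩ := h₂
    refine ⟨m, Finset.mem_union_right _ (Finset.mem_erase.2 ⟨?_, hm⟩), hmv⟩
    rintro rfl
    exact Literal.val_opp.1 hmv hv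
  · obtain ⟨m, hm, hmv⟩ := h₁
    refine ⟨m, Finset.mem_union_left _ (Finset.mem_erase.2 ⟨?_, hm⟩), hmv⟩
    rintro rfl
    exact hv hmv

theorem Derives.not_isTautology {F : Set Clause} (hF : TautologyFree F) {c : Clause}
    (h : Derives F c) : ¬ c.IsTautology := by
  cases h with
  | mem h => exact hF _ h
  | step _ _ h => exact h.2.2.1

/-! ### Robust satisfaction and the one-step criterion -/

/-- The assignment `v` satisfies `d` even after removing the opposite of any one literal of `c`. -/
def RobustlySatisfied (c d : Clause) (v : Variable → Bool) : Prop :=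
  d.SatisfiedBy v ∧ ∀ l ∈ c, Clause.SatisfiedBy (d.erase l.opp) v

/-- Soundness of resolution, applied to the parents with `l.opp` erased: the parent whose pivot
literal is false has a true literal that is neither erased nor the pivot, and it survives in the
resolvent. -/
theorem Resolvent.robustlySatisfied {c c₁ c₂ d : Clause} (h : Resolvent c₁ c₂ d)
    {v : Variable → Bool} (h₁ : RobustlySatisfied c c₁ v) (h₂ : RobustlySatisfied c c₂ v) :
    RobustlySatisfied c d v := by
  refine ⟨h.satisfiedBy h₁.1 h₂.1, fun l hl => ?_⟩
  obtain ⟨-, -, -, k, hk, hk', rfl⟩ := h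
  by_cases hv : v k.1 = k.2
  · obtain ⟨m, hm, hmv⟩ := h₂.2 l hl
    rw [Finset.mem_erase] at hm
    refine ⟨m, Finset.mem_erase.2 ⟨hm.1, Finset.mem_union_right _
      (Finset.mem_erase.2 ⟨?_, hm.2⟩)⟩, hmv⟩
    rintro rfl
    exact Literal.val_opp.1 hmv hv
  · obtain ⟨m, hm, hmv⟩ := h₁.2 l hl
    rw [Finset.mem_erase] at hm
    refine ⟨m, Finset.mem_erase.2 ⟨hm.1, Finset.mem_union_left _
      (Finset.mem_erase.2 ⟨?_, hm.2⟩)⟩, hmv⟩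
    rintro rfl
    exact hv hmv

theorem Resolvent.symm {c₁ c₂ d : Clause} (h : Resolvent c₁ c₂ d) : Resolvent c₂ c₁ d := by
  obtain ⟨h₁, h₂, h₃, k, hk, hk', rfl⟩ := h
  exact ⟨h₂, h₁, h₃, k.opp, hk', by simpa using hk, by rw [Literal.opp_opp, Finset.union_comm]⟩

/-- Resolving a robustly satisfied clause with `c` itself. -/
theorem Resolvent.robustlySatisfied_self {c c₂ d : Clause} (h : Resolvent c c₂ d)
    {v : Variable → Bool} (h₂ : RobustlySatisfied c c₂ v) : RobustlySatisfied c d v := by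
  obtain ⟨h₁, -, h₃, k, hk, hk', rfl⟩ := h
  obtain ⟨m, hm, hmv⟩ := h₂.2 k hk
  have key : Clause.SatisfiedBy (c.erase k ∪ c₂.erase k.opp) v :=
    ⟨m, Finset.mem_union_right _ hm, hmv⟩
  refine ⟨key, fun l hl => ?_⟩
  -- The resolvent contains no opposite of a literal of `c`. For the pivot this holds since `c` is
  -- no tautology and the other parent lost it; any other literal of `c` remains in the resolvent,
  -- which is no tautology.
  rwa [Finset.erase_eq_of_notMem]
  by_cases hlk : l = k
  · subst hlk
    simp only [Finset.mem_union, Finset.mem_erase, not_or, not_and]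
    exact ⟨fun _ => Clause.IsTautology.not_mem h₁ hl, fun h => absurd rfl h⟩
  · exact Clause.IsTautology.not_mem h₃ (Finset.mem_union_left _ (Finset.mem_erase.2 ⟨hlk, hl⟩))

/-- The clause `c` may itself be used in the derivation, although it is false: steps with `c` as a
parent are covered by `robustlySatisfied_self`, and `c` cannot be both parents because a clause that
resolves with itself is a tautology. -/
theorem Derives.robustlySatisfied {F : Set Clause} {c : Clause} {v : Variable → Bool}
    (h : ∀ d ∈ F, d ≠ c → RobustlySatisfied c d v) {d : Clause} (hd : Derives F d) :
    d ≠ c → RobustlySatisfied c d v := by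
  induction hd with
  | mem hd => exact h _ hd
  | @step c₁ c₂ d _ _ hr ih₁ ih₂ =>
    intro _
    by_cases h₁ : c₁ = c
    · subst h₁
      refine hr.robustlySatisfied_self (ih₂ ?_)
      rintro rfl
      obtain ⟨h₁, -, -, k, hk, hk', -⟩ := hr
      exact h₁ ⟨k, hk, hk'⟩
    · by_cases h₂ : c₂ = c
      · subst h₂
        exact hr.symm.robustlySatisfied_self (ih₁ h₁)
      · exact hr.robustlySatisfied (ih₁ h₁) (ih₂ h₂)

theorem robustlySatisfied_iff {F : Set Clause} (hF : TautologyFree F) {c : Clause} (hc : c ∈ F)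
    {v : Variable → Bool} (hv : ¬ c.SatisfiedBy v) :
    (∀ d ∈ (F \ {c}) ∪ resolve F {c}, d.SatisfiedBy v) ↔
      ∀ d ∈ F, d ≠ c → RobustlySatisfied c d v := by
  have hfalse : ∀ l ∈ c, v l.opp.1 = l.opp.2 := fun l hl =>
    Literal.val_opp.2 fun h => hv ⟨l, hl, h⟩
  constructor
  · intro h d hd hdc
    refine ⟨h d (Or.inl ⟨hd, hdc⟩), fun l hl => ?_⟩
    by_cases hld : l.opp ∈ d
    -- If `d` and `c` do not resolve because the result would be a tautology, then `d` contains the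
    -- opposite of a second literal of `c`, which `v` makes true. Otherwise the resolvent is
    -- satisfied, and not by its part from `c`.
    · by_cases ht : Clause.IsTautology (d.erase l.opp ∪ c.erase l)
      · have key : ∀ m ∈ c.erase l, m.opp ∈ d.erase l.opp →
            Clause.SatisfiedBy (d.erase l.opp) v := fun m hm hm' =>
          ⟨m.opp, hm', hfalse m (Finset.mem_of_mem_erase hm)⟩
        obtain ⟨m, hm, hm'⟩ := ht
        rcases Finset.mem_union.1 hm with hm | hm <;> rcases Finset.mem_union.1 hm' with hm' | hm'
        · exact absurd (Finset.mem_of_mem_erase hm')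
            (Clause.IsTautology.not_mem (hF d hd) (Finset.mem_of_mem_erase hm))
        · exact key _ hm' (by simpa using hm)
        · exact key _ hm hm'
        · exact absurd (Finset.mem_of_mem_erase hm')
            (Clause.IsTautology.not_mem (hF c hc) (Finset.mem_of_mem_erase hm))
      · obtain ⟨m, hm, hmv⟩ := h (d.erase l.opp ∪ c.erase l) (Or.inr ⟨d, hd, c, rfl, hF d hd,
          hF c hc, ht, l.opp, hld, by simpa using hl, by simp⟩)
        rcases Finset.mem_union.1 hm with hm | hm
        · exact ⟨m, hm, hmv⟩
        · exact absurd ⟨m, Finset.mem_of_mem_erase hm, hmv⟩ hv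
    · rw [Finset.erase_eq_of_notMem hld]
      exact h d (Or.inl ⟨hd, hdc⟩)
  · rintro h d (⟨hd, hdc⟩ | ⟨d', hd', c', rfl, hr⟩)
    · exact (h d hd hdc).1
    · refine (hr.symm.robustlySatisfied_self (h d' hd' ?_)).1
      rintro rfl
      obtain ⟨h₁, -, -, k, hk, hk', -⟩ := hr
      exact h₁ ⟨k, hk, hk'⟩

/-- Resolution removes the pivot from `c`, and the other parent cannot bring it back because it
contains the opposite literal and is no tautology. -/
theorem not_mem_resolve_self {F : Set Clause} {c : Clause} : c ∉ resolve F {c} := by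
  rintro ⟨d, -, c', rfl, h₁, h₂, h₃, k, hk, hk', h⟩
  rw [h, Finset.mem_union] at hk'
  rcases hk' with hk' | hk'
  · exact h₁ ⟨k, hk, Finset.mem_of_mem_erase hk'⟩
  · simp at hk'

/-- A clause is superredundant if and only if it follows from the other clauses and the clauses
that are obtained by resolving it once. -/
theorem superredundant_iff {F : Set Clause} (hF : TautologyFree F) {c : Clause} (hc : c ∈ F) :
    Superredundant F c ↔ Entails ((F \ {c}) ∪ resolve F {c}) c := by
  constructor
  · intro h v hv
    by_contra hcv
    refine hcv (h v fun d hd => ?_)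
    exact (Derives.robustlySatisfied ((robustlySatisfied_iff hF hc hcv).1 hv) hd.1 hd.2).1
  · intro h v hv
    refine h v fun d hd => hv d ⟨?_, ?_⟩
    · rcases hd with hd | ⟨d', hd', c', rfl, hr⟩
      · exact Derives.mem hd.1
      · exact Derives.step (Derives.mem hd') (Derives.mem hc) hr
    · rcases hd with hd | hd
      · exact hd.2
      · rintro rfl
        exact not_mem_resolve_self hd

theorem superredundant_iff_robustlySatisfied {F : Set Clause} (hF : TautologyFree F) {c : Clause}
    (hc : c ∈ F) : Superredundant F c ↔
      ¬ ∃ v, ¬ c.SatisfiedBy v ∧ ∀ d ∈ F, d ≠ c → RobustlySatisfied c d v := by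
  rw [superredundant_iff hF hc]
  constructor
  · rintro h ⟨v, hv, hd⟩
    exact hv (h v ((robustlySatisfied_iff hF hc hv).2 hd))
  · intro h v hd
    by_contra hv
    exact h ⟨v, hv, (robustlySatisfied_iff hF hc hv).1 hd⟩

/-! ### Horn and Krom formulae are closed under resolution -/

/-- The parent with the positive pivot loses its only positive literal, so all positive literals of
the resolvent come from the other parent. -/
theorem IsHorn.resCn {F : Set Clause} (hF : IsHorn F) : IsHorn (ResCn F) := by
  refine ⟨fun c hc => Derives.not_isTautology hF.1 hc, fun c hc => ?_⟩
  induction hc with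
  | mem h => exact hF.2 _ h
  | @step c₁ c₂ c _ _ hr ih₁ ih₂ =>
    have key : ∀ {c₁ c₂ : Clause} {l : Literal}, l ∈ c₁ → l.2 = true →
        (c₁.filter fun l => l.2 = true).card ≤ 1 → (c₂.filter fun l => l.2 = true).card ≤ 1 →
        ((c₁.erase l ∪ c₂.erase l.opp).filter fun l => l.2 = true).card ≤ 1 := by
      intro c₁ c₂ l hl hl2 h₁ h₂
      refine le_trans (Finset.card_le_card fun m hm => ?_) h₂
      simp only [Finset.mem_filter, Finset.mem_union, Finset.mem_erase] at hm ⊢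
      rcases hm with ⟨hm | hm, hm2⟩
      · refine absurd ?_ hm.1
        exact Finset.card_le_one.1 h₁ m (Finset.mem_filter.2 ⟨hm.2, hm2⟩) l
          (Finset.mem_filter.2 ⟨hl, hl2⟩)
      · exact ⟨hm.2, hm2⟩
    obtain ⟨-, -, -, l, hl, hl', rfl⟩ := hr
    by_cases hl2 : l.2 = true
    · exact key hl hl2 ih₁ ih₂
    · have := key (l := l.opp) hl' (by simpa [Literal.opp] using hl2) ih₂ ih₁
      rwa [Literal.opp_opp, Finset.union_comm] at this

/-- Each parent loses its pivot, hence contributes at most one literal. -/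
theorem IsKrom.resCn {F : Set Clause} (hF : IsKrom F) : IsKrom (ResCn F) := by
  refine ⟨fun c hc => Derives.not_isTautology hF.1 hc, fun c hc => ?_⟩
  induction hc with
  | mem h => exact hF.2 _ h
  | @step c₁ c₂ c _ _ hr ih₁ ih₂ =>
    obtain ⟨-, -, -, l, hl, hl', rfl⟩ := hr
    have := Finset.card_union_le (c₁.erase l) (c₂.erase l.opp)
    have h₁ := Finset.card_erase_of_mem hl
    have h₂ := Finset.card_erase_of_mem hl'
    omega

/-! ### Structured stack programs and their compilation to multi-stack Turing machines -/

namespace StackProgram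

/-- The memory of a stack program: a register, an input stack and some work stacks. -/
structure Memory (ι I W R : Type) where
  reg : R
  inp : List I
  stk : ι → List W

/-- Structured programs that operate on an input stack and on work stacks. -/
inductive Prog (ι I W R : Type)
  | read (f : R → Option I → R)
  | pop (i : ι) (f : R → Option W → R)
  | push (i : ι) (f : R → W)
  | load (f : R → R)
  | seq (p q : Prog ι I W R)
  | ite (b : R → Bool) (p q : Prog ι I W R)
  | loop (b : R → Bool) (p : Prog ι I W R)

variable {ι I W R : Type} [DecidableEq ι]

/-- `Exec p s t s'`: the program `p` leads from the memory `s` to the memory `s'` in `t` steps. -/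
inductive Exec : Prog ι I W R → Memory ι I W R → ℕ → Memory ι I W R → Prop
  | read (f s) : Exec (.read f) s 1 ⟨f s.reg s.inp.head?, s.inp.tail, s.stk⟩
  | pop (i f s) : Exec (.pop i f) s 1
      ⟨f s.reg (s.stk i).head?, s.inp, Function.update s.stk i (s.stk i).tail⟩
  | push (i f s) : Exec (.push i f) s 1
      ⟨s.reg, s.inp, Function.update s.stk i (f s.reg :: s.stk i)⟩
  | load (f s) : Exec (.load f) s 1 ⟨f s.reg, s.inp, s.stk⟩
  | seq {p q s s' s'' t t'} : Exec p s t s' → Exec q s' t' s'' → Exec (.seq p q) s (t + t') s''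
  | ite_true {b p q s s' t} : b s.reg = true → Exec p s t s' → Exec (.ite b p q) s (1 + t) s'
  | ite_false {b p q s s' t} : b s.reg = false → Exec q s t s' → Exec (.ite b p q) s (1 + t) s'
  | loop_true {b p s s' s'' t t'} : b s.reg = true → Exec p s t s' → Exec (.loop b p) s' t' s'' →
      Exec (.loop b p) s (1 + t + t') s''
  | loop_false {b p s} : b s.reg = false → Exec (.loop b p) s 1 s

/-- The labels of the machine code of a program. -/
def Label : Prog ι I W R → Type
  | .seq p q => Label p ⊕ Label q
  | .ite _ p q => Option (Label p ⊕ Label q)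
  | .loop _ p => Option (Label p)
  | _ => Unit

instance Label.fintype : (p : Prog ι I W R) → Fintype (Label p)
  | .read _ => inferInstanceAs (Fintype Unit)
  | .pop _ _ => inferInstanceAs (Fintype Unit)
  | .push _ _ => inferInstanceAs (Fintype Unit)
  | .load _ => inferInstanceAs (Fintype Unit)
  | .seq p q =>
    have := Label.fintype p
    have := Label.fintype q
    inferInstanceAs (Fintype (Label p ⊕ Label q))
  | .ite _ p q =>
    have := Label.fintype p
    have := Label.fintype q
    inferInstanceAs (Fintype (Option (Label p ⊕ Label q)))
  | .loop _ p =>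
    have := Label.fintype p
    inferInstanceAs (Fintype (Option (Label p)))

/-- The label at which the code of a program starts. -/
def entry : (p : Prog ι I W R) → Label p
  | .read _ => ()
  | .pop _ _ => ()
  | .push _ _ => ()
  | .load _ => ()
  | .seq p _ => Sum.inl (entry p)
  | .ite _ _ _ => none
  | .loop _ _ => none

/-- The stacks of the machine: input, output and the work stacks. -/
abbrev StackIndex (ι : Type) : Type := Bool ⊕ ι

/-- The alphabets of the stacks of the machine. -/
abbrev StackAlphabet (ι I W : Type) : StackIndex ι → Type
  | .inl false => I
  | .inl true => Bool
  | .inr _ => W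

/-- The machine code of a program. The labels are embedded by `emb`, and the code jumps to `exit`
when it is done. -/
def code : (p : Prog ι I W R) → {Λ : Type} → (Label p → Λ) → Λ → Label p →
    Turing.TM2.Stmt (StackAlphabet ι I W) Λ R
  | .read f, _, _, exit => fun _ => .pop (.inl false) f (.goto fun _ => exit)
  | .pop i f, _, _, exit => fun _ => .pop (.inr i) f (.goto fun _ => exit)
  | .push i f, _, _, exit => fun _ => .push (.inr i) f (.goto fun _ => exit)
  | .load f, _, _, exit => fun _ => .load f (.goto fun _ => exit)
  | .seq p q, _, emb, exit => fun
    | Sum.inl l => code p (fun l => emb (Sum.inl l)) (emb (Sum.inr (entry q))) l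
    | Sum.inr l => code q (fun l => emb (Sum.inr l)) exit l
  | .ite b p q, _, emb, exit => fun
    | none => .branch b (.goto fun _ => emb (some (Sum.inl (entry p))))
        (.goto fun _ => emb (some (Sum.inr (entry q))))
    | some (Sum.inl l) => code p (fun l => emb (some (Sum.inl l))) exit l
    | some (Sum.inr l) => code q (fun l => emb (some (Sum.inr l))) exit l
  | .loop b p, _, emb, exit => fun
    | none => .branch b (.goto fun _ => emb (some (entry p))) (.goto fun _ => exit)
    | some l => code p (fun l => emb (some l)) (emb none) l

/-- The contents of all stacks of the machine. -/
def contents (inp : List I) (out : List Bool) (stk : ι → List W) :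
    (k : StackIndex ι) → List (StackAlphabet ι I W k)
  | .inl false => inp
  | .inl true => out
  | .inr i => stk i

theorem update_contents_inp (inp inp' : List I) (out : List Bool) (stk : ι → List W) :
    Function.update (contents inp out stk) (.inl false) inp' = contents inp' out stk := by
  funext k
  match k with
  | .inl false => simp [contents]
  | .inl true => simp [contents]
  | .inr i => simp [contents]

theorem update_contents_out (inp : List I) (out out' : List Bool) (stk : ι → List W) :
    Function.update (contents inp out stk) (.inl true) out' = contents inp out' stk := by
  funext k
  match k with
  | .inl false => simp [contents]
  | .inl true => simp [contents]
  | .inr i => simp [contents]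

theorem update_contents_stk (inp : List I) (out : List Bool) (stk : ι → List W) (i : ι)
    (w : List W) :
    Function.update (contents inp out stk) (.inr i) w =
      contents inp out (Function.update stk i w) := by
  funext k
  match k with
  | .inl false => simp [contents]
  | .inl true => simp [contents]
  | .inr j =>
    by_cases h : j = i
    · subst h; simp [contents]
    · simp [contents, h]

/-- The configuration of the machine at a label. -/
def config {Λ : Type} (l : Option Λ) (s : Memory ι I W R) :
    Turing.TM2.Cfg (StackAlphabet ι I W) Λ R :=
  ⟨l, s.reg, contents s.inp [] s.stk⟩

/-- The machine `M`, the embedding of labels and the exit label are arbitrary: the code of a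
subprogram sits inside of a larger machine and exits to the code that follows, or to the head of a
loop. One machine step corresponds to one unit of time in `Exec`. -/
theorem Exec.iterate_step {p : Prog ι I W R} {s s' : Memory ι I W R} {t : ℕ} (h : Exec p s t s')
    {Λ : Type} {M : Λ → Turing.TM2.Stmt (StackAlphabet ι I W) Λ R} {emb : Label p → Λ} {exit : Λ}
    (hM : ∀ l, M (emb l) = code p emb exit l) :
    (flip bind (Turing.TM2.step M))^[t] (some (config (some (emb (entry p))) s)) =
      some (config (some exit) s') := by
  induction h generalizing Λ exit with
  | read f s =>
    simp [flip, config, hM, code, update_contents_inp, contents]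
  | pop i f s =>
    simp [flip, config, hM, code, update_contents_stk, contents]
  | push i f s =>
    simp [flip, config, hM, code, update_contents_stk, contents]
  | load f s =>
    simp [flip, config, hM, code]
  | @seq p q s s' s'' t t' _ _ ih₁ ih₂ =>
    rw [Nat.add_comm, Function.iterate_add_apply]
    have h₁ := ih₁ (M := M) (emb := fun l => emb (Sum.inl l)) (exit := emb (Sum.inr (entry q)))
      fun l => hM (Sum.inl l)
    have h₂ := ih₂ (M := M) (emb := fun l => emb (Sum.inr l)) (exit := exit)
      fun l => hM (Sum.inr l)
    exact (congrArg _ h₁).trans h₂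
  | @ite_true b p q s s' t hb _ ih =>
    rw [Nat.add_comm, Function.iterate_add_apply]
    have h₁ := ih (M := M) (emb := fun l => emb (some (Sum.inl l))) (exit := exit)
      fun l => hM (some (Sum.inl l))
    refine (congrArg _ ?_).trans h₁
    have := hM none
    simp [flip, config, this, code, hb, entry]
  | @ite_false b p q s s' t hb _ ih =>
    rw [Nat.add_comm, Function.iterate_add_apply]
    have h₁ := ih (M := M) (emb := fun l => emb (some (Sum.inr l))) (exit := exit)
      fun l => hM (some (Sum.inr l))
    refine (congrArg _ ?_).trans h₁
    have := hM none
    simp [flip, config, this, code, hb, entry]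
  | @loop_true b p s s' s'' t t' hb _ _ ih₁ ih₂ =>
    rw [Nat.add_comm, Function.iterate_add_apply, Nat.add_comm, Function.iterate_add_apply]
    have h₁ := ih₁ (M := M) (emb := fun l => emb (some l)) (exit := emb none)
      fun l => hM (some l)
    have h₂ := ih₂ (M := M) (emb := emb) (exit := exit) hM
    refine (congrArg _ ((congrArg _ ?_).trans h₁)).trans h₂
    have := hM none
    simp [flip, config, this, code, hb, entry]
  | @loop_false b p s hb =>
    have := hM none
    simp [flip, config, this, code, hb, entry]

/-- The machine that runs a program and then writes the answer that is found in the register. -/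
@[reducible] def machine [Fintype ι] [Fintype I] [Fintype R] (p : Prog ι I W R) (init : R)
    (ans : R → Bool) : Turing.FinTM2 where
  K := StackIndex ι
  k₀ := .inl false
  k₁ := .inl true
  Γ := StackAlphabet ι I W
  Λ := Option (Label p)
  main := some (entry p)
  σ := R
  initialState := init
  Γk₀Fin := inferInstanceAs (Fintype I)
  m := fun
    -- The halting configuration that Mathlib prescribes has the initial register and no stack
    -- contents but the output; this is why the register is reset here and why programs have to
    -- empty their stacks.
    | none => .push (.inl true) ans (.load (fun _ => init) .halt)
    | some l => code p some none l

/-- A program that empties all stacks and leaves the answer in the register yields a machine that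
runs in polynomial time. -/
theorem nonempty_computableInPolyTime [Fintype ι] [Fintype I] [Fintype R] {α : Type}
    {enc : α → List I} {f : α → Bool} (p : Prog ι I W R) (init : R) (ans : R → Bool)
    (time : Polynomial ℕ)
    (h : ∀ a, ∃ t r, t ≤ time.eval (enc a).length ∧
      Exec p ⟨init, enc a, fun _ => []⟩ t ⟨r, [], fun _ => []⟩ ∧ ans r = f a) :
    Nonempty (Turing.TM2ComputableInPolyTime enc Computability.encodeBool f) := by
  choose t r ht hE hr using h
  -- The additional step writes the answer.
  refine ⟨⟨⟨machine p init ans, Equiv.refl I, Equiv.refl Bool⟩, time + 1, fun a =>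
    ⟨⟨t a + 1, ?_⟩, ?_⟩⟩⟩
  · rw [Nat.add_comm, Function.iterate_add_apply]
    have h₁ := (hE a).iterate_step (M := (machine p init ans).m) (emb := some) (exit := none)
      fun l => rfl
    have h₂ : Turing.initList (machine p init ans) (List.map (Equiv.refl I).invFun (enc a)) =
        config (some (some (entry p))) ⟨init, enc a, fun _ => []⟩ := by
      unfold Turing.initList config
      congr 1
      funext k
      match k with
      | .inl false => simp [contents]
      | .inl true => simp [contents]
      | .inr i => simp [contents]
    rw [h₂]
    refine (congrArg _ h₁).trans ?_
    have h₃ : Turing.haltList (machine p init ans)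
        (List.map (Equiv.refl Bool).invFun (Computability.encodeBool (f a))) =
        ⟨none, init, contents [] [ans (r a)] fun _ => []⟩ := by
      unfold Turing.haltList
      congr 1
      funext k
      match k with
      | .inl false => simp [contents]
      | .inl true => simp [contents, hr, Computability.encodeBool]
      | .inr i => simp [contents]
    refine Eq.trans ?_ (congrArg some h₃.symm)
    refine congrArg some (congrArg (Turing.TM2.Cfg.mk none init) ?_)
    exact update_contents_out (W := W) [] [] [ans (r a)] fun _ => []
  · simpa using ht a

/-! ### Upper bounds on running times -/

/-- `Runs p s s' B`: the program `p` leads from `s` to `s'` in at most `B` steps. -/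
def Runs (p : Prog ι I W R) (s s' : Memory ι I W R) (B : ℕ) : Prop := ∃ t ≤ B, Exec p s t s'

theorem Runs.mono {p : Prog ι I W R} {s s' : Memory ι I W R} {B B' : ℕ} (h : Runs p s s' B)
    (hB : B ≤ B') : Runs p s s' B' :=
  let ⟨t, ht, h⟩ := h
  ⟨t, ht.trans hB, h⟩

theorem Runs.seq {p q : Prog ι I W R} {s s' s'' : Memory ι I W R} {B B' : ℕ} (h : Runs p s s' B)
    (h' : Runs q s' s'' B') : Runs (.seq p q) s s'' (B + B') :=
  let ⟨_, ht, h⟩ := h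
  let ⟨_, ht', h'⟩ := h'
  ⟨_, add_le_add ht ht', .seq h h'⟩

theorem Runs.ite {b : R → Bool} {p q : Prog ι I W R} {s s' : Memory ι I W R} {B : ℕ}
    (h : Runs (if b s.reg then p else q) s s' B) : Runs (.ite b p q) s s' (1 + B) := by
  obtain ⟨t, ht, h⟩ := h
  refine ⟨1 + t, by omega, ?_⟩
  split_ifs at h with hb
  · exact .ite_true hb h
  · exact .ite_false (by simpa using hb) h

theorem Runs.loop_true {b : R → Bool} {p : Prog ι I W R} {s s' s'' : Memory ι I W R} {B B' : ℕ}
    (hb : b s.reg = true) (h : Runs p s s' B) (h' : Runs (.loop b p) s' s'' B') :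
    Runs (.loop b p) s s'' (1 + B + B') :=
  let ⟨_, ht, h⟩ := h
  let ⟨_, ht', h'⟩ := h'
  ⟨_, by omega, .loop_true hb h h'⟩

theorem Runs.loop_false {b : R → Bool} {p : Prog ι I W R} {s : Memory ι I W R}
    (hb : b s.reg = false) : Runs (.loop b p) s s 1 :=
  ⟨1, le_rfl, .loop_false hb⟩

theorem Runs.read {f : R → Option I → R} {s s' : Memory ι I W R}
    (h : s' = ⟨f s.reg s.inp.head?, s.inp.tail, s.stk⟩) : Runs (.read f) s s' 1 :=
  ⟨1, le_rfl, h ▸ .read f s⟩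

theorem Runs.pop {i : ι} {f : R → Option W → R} {s s' : Memory ι I W R}
    (h : s' = ⟨f s.reg (s.stk i).head?, s.inp, Function.update s.stk i (s.stk i).tail⟩) :
    Runs (.pop i f) s s' 1 :=
  ⟨1, le_rfl, h ▸ .pop i f s⟩

theorem Runs.push {i : ι} {f : R → W} {s s' : Memory ι I W R}
    (h : s' = ⟨s.reg, s.inp, Function.update s.stk i (f s.reg :: s.stk i)⟩) :
    Runs (.push i f) s s' 1 :=
  ⟨1, le_rfl, h ▸ .push i f s⟩

theorem Runs.load {f : R → R} {s s' : Memory ι I W R} (h : s' = ⟨f s.reg, s.inp, s.stk⟩) :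
    Runs (.load f) s s' 1 :=
  ⟨1, le_rfl, h ▸ .load f s⟩

/-- A loop that consumes, in each round, one element of a list. -/
theorem Runs.loop_list {b : R → Bool} {p : Prog ι I W R} {α A : Type} (xs : List α)
    (st : A → List α → Memory ι I W R) (g : A → α → A) (inv : A → Prop) {B : ℕ}
    (hnil : ∀ a, inv a → b (st a []).reg = false)
    (hcons : ∀ a x ys, inv a → x ∈ xs → b (st a (x :: ys)).reg = true)
    (hbody : ∀ a x ys, inv a → x ∈ xs → Runs p (st a (x :: ys)) (st (g a x) ys) B)
    (hinv : ∀ a x, inv a → x ∈ xs → inv (g a x)) (a : A) (ha : inv a) :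
    Runs (.loop b p) (st a xs) (st (xs.foldl g a) []) (xs.length * (B + 1) + 1) := by
  induction xs generalizing a with
  | nil => simpa using Runs.loop_false (hnil a ha)
  | cons x xs ih =>
    have h₁ := hbody a x xs ha (by simp)
    have h₂ := ih (fun a y ys ha hy => hcons a y ys ha (by simp [hy]))
      (fun a y ys ha hy => hbody a y ys ha (by simp [hy]))
      (fun a y ha hy => hinv a y ha (by simp [hy])) (g a x) (hinv a x ha (by simp))
    refine (Runs.loop_true (hcons a x xs ha (by simp)) h₁ h₂).mono ?_
    simp only [List.length_cons]
    ring_nf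
    omega

/-! ### Memory layout and elementary subroutines -/

/-- Marks of the occurrences of literals. Dead literals are ignored by unit propagation. -/
inductive Mark
  | unset
  | yes
  | no
  | dead
  deriving DecidableEq

instance : Fintype Mark :=
  ⟨{.unset, .yes, .no, .dead}, fun μ => by cases μ <;> simp⟩

/-- Marks of clauses: does the clause lack a literal of the clause to be checked, does it contain
the opposite of at least one or at least two of them, and does unit propagation use it? -/
structure Tag where
  missing : Bool
  hit : Bool
  twice : Bool
  active : Bool
  deriving DecidableEq, Fintype

/-- The alphabet of the work stacks. -/
inductive Cell
  | bit (b : Bool)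
  | sign (b : Bool) (μ : Mark)
  | fin (e : Tag)
  deriving DecidableEq, Fintype

/-- Flags of the passes over the formula. -/
@[ext] structure Flags where
  seen : Bool
  other : Bool
  found : Bool
  first : Bool
  ans : Bool
  deriving DecidableEq, Fintype

/-- The finite control. -/
structure Reg where
  cur : Option Cell
  aux : Option Cell
  eq : Bool
  fl : Flags
  deriving DecidableEq, Fintype

/-- The work stacks: the formula, a stack for its processed part, a stack for temporary storage,
and for each of four loops over literals the list of the literals, its processed part, and the
current literal. -/
inductive Stk
  | fa
  | fb
  | t
  | x (i : Fin 4)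
  | y (i : Fin 4)
  | m (i : Fin 4)
  deriving DecidableEq, Fintype

/-- Programs over the work stacks. -/
abbrev Program : Type := Prog Stk Symbol Cell Reg

/-- Their memories. -/
abbrev Mem : Type := Memory Stk Symbol Cell Reg

/-- The control between two subroutines. -/
def Reg.rest (fl : Flags) : Reg := ⟨none, none, true, fl⟩

def Reg.setCur (r : Reg) (c : Option Cell) : Reg := { r with cur := c }

def Reg.setAux (r : Reg) (c : Option Cell) : Reg := { r with aux := c }

def Reg.compareAux (r : Reg) (c : Option Cell) : Reg :=
  { r with aux := c, eq := r.eq && decide (c = r.cur) }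

def Reg.getCur (r : Reg) : Cell := r.cur.getD (.bit false)

def Reg.getAux (r : Reg) : Cell := r.aux.getD (.bit false)

def Reg.hasCur (r : Reg) : Bool := r.cur.isSome

def Reg.hasAux (r : Reg) : Bool := r.aux.isSome

def Reg.isBit (r : Reg) : Bool :=
  match r.cur with
  | some (.bit _) => true
  | _ => false

def Reg.isSign (r : Reg) : Bool :=
  match r.cur with
  | some (.sign _ _) => true
  | _ => false

/-- Move the contents of the stack `a` to the stack `b`, which reverses them. -/
def transfer (a b : Stk) : Program :=
  .seq (.pop a Reg.setCur) (.loop Reg.hasCur (.seq (.push b Reg.getCur) (.pop a Reg.setCur)))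

open Function (update)

theorem runs_transfer {a b : Stk} (hab : a ≠ b) (r : Reg) (inp : List Symbol)
    (S : Stk → List Cell) :
    Runs (transfer a b) ⟨r, inp, S⟩
      ⟨r.setCur none, inp, update (update S a []) b ((S a).reverse ++ S b)⟩
      (3 * (S a).length + 2) := by
  have key := Runs.loop_list (b := Reg.hasCur)
    (p := Prog.seq (I := Symbol) (.push b Reg.getCur) (.pop a Reg.setCur)) (S a)
    (fun (acc : List Cell) ys =>
      ⟨r.setCur ys.head?, inp, update (update S a ys.tail) b acc⟩)
    (fun acc c => c :: acc) (fun _ => True) (B := 2)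
    (fun _ _ => rfl) (fun _ _ _ _ _ => rfl)
    (fun acc c ys _ _ => by
      refine Runs.seq (B := 1) (B' := 1) (.push rfl) (.pop ?_)
      simp only [Reg.setCur, Reg.getCur, Memory.mk.injEq, true_and, List.head?_cons,
        Option.getD_some, List.tail_cons]
      constructor
      · simp [hab]
      · funext k
        simp only [Function.update_apply]
        split_ifs <;> simp_all)
    (fun _ _ _ _ => trivial) (S b) trivial
  have h₁ : (S a).foldl (fun acc c => c :: acc) (S b) = (S a).reverse ++ S b := by
    simp
  have h₂ : update (update S a (S a).tail) b (S b) = update S a (S a).tail := by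
    funext k
    simp only [Function.update_apply]
    split_ifs <;> simp_all
  rw [h₁, h₂] at key
  exact (Runs.seq (B := 1) (.pop rfl) key).mono (by omega)

/-- Do nothing. -/
def nop : Program := .load id

theorem runs_nop (s : Mem) : Runs nop s s 1 := .load rfl

/-- Empty the stack `a`. -/
def clear (a : Stk) : Program :=
  .seq (.pop a Reg.setCur) (.loop Reg.hasCur (.pop a Reg.setCur))

theorem runs_clear (a : Stk) (r : Reg) (inp : List Symbol) (S : Stk → List Cell) :
    Runs (clear a) ⟨r, inp, S⟩ ⟨r.setCur none, inp, update S a []⟩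
      (2 * (S a).length + 2) := by
  have key := Runs.loop_list (b := Reg.hasCur) (p := Prog.pop (I := Symbol) a Reg.setCur) (S a)
    (fun (_ : Unit) ys => ⟨r.setCur ys.head?, inp, update S a ys.tail⟩)
    (fun _ _ => ()) (fun _ => True) (B := 1)
    (fun _ _ => rfl) (fun _ _ _ _ _ => rfl)
    (fun acc c ys _ _ => by
      refine Runs.pop ?_
      simp [Reg.setCur])
    (fun _ _ _ _ => trivial) () trivial
  exact (Runs.seq (B := 1) (.pop rfl) key).mono (by omega)

/-! ### Passes over the formula that compare its literals with a current literal -/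

/-- The result of comparing a literal `l` with a literal `m`: `some true` if they are the same,
`some false` if they are opposite. -/
def compareLiteral (m l : Literal) : Option Bool := if m.1 = l.1 then some (m.2 == l.2) else none

/-- What a pass over the formula does at the literals and at the ends of the clauses. -/
structure Transducer where
  lit : Flags → Mark → Option Bool → Flags × Mark
  fin : Flags → Tag → Flags × Tag

/-- The items of a formula: marked literals and ends of clauses. -/
inductive Item
  | lit (l : Literal) (μ : Mark)
  | fin (e : Tag)

/-- The word that represents a literal. -/
def encodeMarked (l : Literal) (μ : Mark) : List Cell :=
  l.1.reverse.map Cell.bit ++ [Cell.sign l.2 μ]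

/-- The word that represents an item. -/
def Item.encode : Item → List Cell
  | .lit l μ => encodeMarked l μ
  | .fin e => [Cell.fin e]

/-- What a transducer does at one item. -/
def Transducer.step (τ : Transducer) (m : Literal) (fl : Flags) : Item → Flags × Item
  | .lit l μ => ((τ.lit fl μ (compareLiteral m l)).1, .lit l (τ.lit fl μ (compareLiteral m l)).2)
  | .fin e => ((τ.fin fl e).1, .fin (τ.fin fl e).2)

/-- What a transducer does in one pass. -/
def Transducer.run (τ : Transducer) (m : Literal) : Flags → List Item → Flags × List Item
  | fl, [] => (fl, [])
  | fl, i :: is =>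
    ((τ.run m (τ.step m fl i).1 is).1, (τ.step m fl i).2 :: (τ.run m (τ.step m fl i).1 is).2)

/-- Compare the bits of a literal of the formula with those of the literal on `m i`. -/
def compareBits (i : Fin 4) : Program :=
  .loop Reg.isBit (.seq (.push .fb Reg.getCur) (.seq (.pop (.m i) Reg.compareAux)
    (.seq (.ite Reg.hasAux (.push .t Reg.getAux) nop) (.pop .fa Reg.setCur))))

/-- Let the transducer act on a sign. -/
def Reg.applyLit (τ : Transducer) (r : Reg) : Reg :=
  match r.cur with
  | some (.sign b μ) =>
    let d : Option Bool := match r.eq, r.aux with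
      | true, some (.sign b' _) => some (b' == b)
      | _, _ => none
    ⟨some (.sign b (τ.lit r.fl μ d).2), none, true, (τ.lit r.fl μ d).1⟩
  | _ => r

/-- Let the transducer act on the end of a clause. -/
def Reg.applyFin (τ : Transducer) (r : Reg) : Reg :=
  match r.cur with
  | some (.fin e) => ⟨some (.fin (τ.fin r.fl e).2), none, true, (τ.fin r.fl e).1⟩
  | _ => r

/-- Process a sign. -/
def signStep (i : Fin 4) (τ : Transducer) : Program :=
  .seq (.pop (.m i) Reg.setAux) (.seq (.ite Reg.hasAux (.push .t Reg.getAux) nop)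
    (.seq (.load (Reg.applyLit τ)) (.seq (.push .fb Reg.getCur) (transfer .t (.m i)))))

/-- Process the end of a clause. -/
def finStep (τ : Transducer) : Program :=
  .seq (.load (Reg.applyFin τ)) (.push .fb Reg.getCur)

/-- Process an item. -/
def itemStep (i : Fin 4) (τ : Transducer) : Program :=
  .seq (compareBits i) (.seq (.ite Reg.isSign (signStep i τ) (finStep τ)) (.pop .fa Reg.setCur))

/-- Run a transducer on the formula and compare its literals with the literal on `m i`. -/
def pass (i : Fin 4) (τ : Transducer) : Program :=
  .seq (.pop .fa Reg.setCur) (.seq (.loop Reg.hasCur (itemStep i τ)) (transfer .fb .fa))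

/-- The part of the memory that changes while the bits of a literal are compared. -/
structure Comparison where
  fb : List Cell
  m : List Cell
  t : List Cell
  aux : Option Cell
  eq : Bool

/-- If the name on `m` is shorter than the one being compared, `head?` is `none`, which differs from
every bit, so the comparison fails for good. -/
def Comparison.step (a : Comparison) (b : Bool) : Comparison :=
  ⟨.bit b :: a.fb, a.m.tail, a.m.head?.toList ++ a.t, a.m.head?,
    a.eq && decide (a.m.head? = some (.bit b))⟩

theorem Comparison.foldl_fb (bs : List Bool) (a : Comparison) :
    (bs.foldl step a).fb = (bs.map Cell.bit).reverse ++ a.fb := by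
  induction bs generalizing a with
  | nil => rfl
  | cons b bs ih => simp [ih, step]

/-- What is popped from `m` is kept on `t`, so that the current literal can be restored for the next
comparison. -/
theorem Comparison.foldl_t (bs : List Bool) (a : Comparison) :
    (bs.foldl step a).t.reverse ++ (bs.foldl step a).m = a.t.reverse ++ a.m := by
  induction bs generalizing a with
  | nil => rfl
  | cons b bs ih =>
    rw [List.foldl_cons, ih]
    rcases a with ⟨_, _ | ⟨c, m⟩, _, _, _⟩ <;> simp [step]

/-- Reading off a prefix: the comparison succeeds with remainder `z` exactly if the word on `m` was
the bits followed by `z`. Names of different lengths are then told apart by whether the remainder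
starts with a sign. -/
theorem Comparison.foldl_eq (bs : List Bool) (a : Comparison) (z : List Cell) :
    ((bs.foldl step a).eq = true ∧ (bs.foldl step a).m = z) ↔
      (a.eq = true ∧ a.m = bs.map Cell.bit ++ z) := by
  induction bs generalizing a with
  | nil => rfl
  | cons b bs ih =>
    rw [List.foldl_cons, ih]
    rcases a with ⟨_, _ | ⟨c, m⟩, _, _, _⟩ <;> simp [step, and_assoc]

/-- The memory while the bits of a literal are compared. -/
def Comparison.mem (i : Fin 4) (fl : Flags) (inp : List Symbol) (S : Stk → List Cell)
    (a : Comparison) (w : List Cell) : Mem :=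
  ⟨⟨w.head?, a.aux, a.eq, fl⟩, inp,
    update (update (update (update S .fa w.tail) .fb a.fb) (.m i) a.m) .t a.t⟩

theorem runs_compareBits (i : Fin 4) (fl : Flags) (inp : List Symbol) (S : Stk → List Cell)
    (a : Comparison) (bs : List Bool) (z : Cell) (hz : ∀ b, z ≠ .bit b) (w : List Cell) :
    Runs (compareBits i) (a.mem i fl inp S (bs.map Cell.bit ++ z :: w))
      ((bs.foldl Comparison.step a).mem i fl inp S (z :: w)) (6 * bs.length + 1) := by
  refine (Runs.loop_list bs (fun a ys => Comparison.mem i fl inp S a (ys.map Cell.bit ++ z :: w))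
    Comparison.step (fun _ => True) (B := 5) ?_ ?_ ?_ (fun _ _ _ _ => trivial) a trivial).mono
    (by omega)
  · intro a _
    rcases z with b | _ | _
    · exact absurd rfl (hz b)
    · rfl
    · rfl
  · intro a x ys _ _
    rfl
  · intro a b ys _ _
    refine (Runs.seq (B := 1) (B' := 4) (.push rfl) (Runs.seq (B := 1) (B' := 3) (.pop rfl)
      (Runs.seq (B := 2) (B' := 1)
        (s' := ⟨⟨some (.bit b), a.m.head?, a.eq && decide (a.m.head? = some (.bit b)), fl⟩, inp,
          update (update (update (update S .fa (ys.map Cell.bit ++ z :: w)) .fb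
            (.bit b :: a.fb)) (.m i) a.m.tail) .t (a.m.head?.toList ++ a.t)⟩)
        (Runs.ite (B := 1) ?_) (.pop ?_)))).mono (by omega)
    · rcases a with ⟨_, _ | ⟨c, m⟩, _, _, _⟩
      · simp only [Comparison.mem, Reg.compareAux, Reg.hasAux]
        simp only [ne_eq, reduceCtorEq, not_false_eq_true, Function.update_of_ne,
          Function.update_self, List.head?_nil, Option.isSome_none, Bool.false_eq_true, ite_false]
        refine .load ?_
        simp only [Memory.mk.injEq, id, Reg.getCur, true_and]
        refine ⟨by simp, ?_⟩
        funext k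
        simp only [Function.update_apply]
        split_ifs <;> simp_all
      · simp only [Comparison.mem, Reg.compareAux, Reg.hasAux]
        simp only [ne_eq, reduceCtorEq, not_false_eq_true, Function.update_of_ne,
          Function.update_self, List.head?_cons, Option.isSome_some, if_true]
        refine .push ?_
        simp only [Memory.mk.injEq, Reg.getCur, Reg.getAux, true_and]
        refine ⟨by simp, ?_⟩
        funext k
        simp only [Function.update_apply]
        split_ifs <;> simp_all
    · simp only [Comparison.mem, Comparison.step, Reg.setCur, Memory.mk.injEq, true_and]
      refine ⟨by simp, ?_⟩
      funext k
      simp only [Function.update_apply]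
      split_ifs <;> simp_all

/-- The word that represents a list of items. -/
def encodeItems (is : List Item) : List Cell := is.flatMap Item.encode

theorem compare_eq {bs : List Bool} {a : Comparison} {l m : Literal} {μ : Mark}
    (hl : bs = l.1.reverse) (ha : a.eq = true) (hm : a.m = encodeMarked m μ) :
    (match (bs.foldl Comparison.step a).eq, (bs.foldl Comparison.step a).m.head? with
      | true, some (.sign b' _) => some (b' == l.2)
      | _, _ => none) = compareLiteral m l := by
  have key := Comparison.foldl_eq bs a
  generalize bs.foldl Comparison.step a = r at key
  rcases r with ⟨fb, rm, rt, raux, req⟩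
  simp only [ha, hm, encodeMarked, hl, true_and] at key
  by_cases h : m.1 = l.1
  · obtain ⟨h₁, h₂⟩ := (key [Cell.sign m.2 μ]).2 (by rw [h])
    simp [compareLiteral, h, h₁, h₂]
  · simp only [compareLiteral, h, if_false]
    rcases req with _ | _
    · rfl
    rcases rm with _ | ⟨_ | ⟨b', μ'⟩ | _, rm⟩
    · rfl
    · rfl
    -- A sign at the head of the remainder means that both words have the same bits in front of
    -- their first sign. Cutting there turns equality of words into equality of names, against `h`.
    · have h₄ := congrArg (List.takeWhile fun c : Cell => match c with
        | .bit _ => true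
        | _ => false) ((key _).1 ⟨rfl, rfl⟩)
      have hbit : ∀ w : List Bool, ∀ c ∈ w.map Cell.bit, (match c with
        | .bit _ => true
        | _ => false) = true := by
        intro w c hc
        obtain ⟨b, -, rfl⟩ := List.mem_map.1 hc
        rfl
      rw [List.takeWhile_append_of_pos (hbit _), List.takeWhile_append_of_pos (hbit _)] at h₄
      simp only [List.takeWhile_cons_of_neg, Bool.false_eq_true, not_false_eq_true,
        List.append_nil] at h₄
      exact absurd (List.reverse_injective
        (List.map_injective_iff.2 (fun a b h => by injection h) h₄)) h
    · rfl

/-- Moving `t` back to `m i` restores the current literal, whatever the outcome of the comparison;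
the sign is written to `fb` with its new mark. -/
theorem runs_signStep (i : Fin 4) (τ : Transducer) (fl : Flags) (inp : List Symbol)
    (S : Stk → List Cell) (a : Comparison) (b : Bool) (μ : Mark) (w : List Cell) (d : Option Bool)
    (hd : (match a.eq, a.m.head? with
      | true, some (.sign b' _) => some (b' == b)
      | _, _ => none) = d) {n : ℕ} (hn : (a.t.reverse ++ a.m).length ≤ n) :
    Runs (signStep i τ) (a.mem i fl inp S (.sign b μ :: w))
      ⟨Reg.rest (τ.lit fl μ d).1, inp,
        update (update (update (update S .fa w) .fb (.sign b (τ.lit fl μ d).2 :: a.fb)) (.m i)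
          (a.t.reverse ++ a.m)) .t []⟩ (3 * n + 7) := by
  have h₁ : Runs (.ite Reg.hasAux (.push .t Reg.getAux) nop : Program)
      ⟨⟨some (.sign b μ), a.m.head?, a.eq, fl⟩, inp,
        update (update (update (update S .fa w) .fb a.fb) (.m i) a.m.tail) .t a.t⟩
      ⟨⟨some (.sign b μ), a.m.head?, a.eq, fl⟩, inp,
        update (update (update (update S .fa w) .fb a.fb) (.m i) a.m.tail) .t
          (a.m.head?.toList ++ a.t)⟩ (1 + 1) := by
    refine Runs.ite ?_
    rcases a with ⟨_, _ | ⟨c, m⟩, _, _, _⟩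
    · simp only [Reg.hasAux, List.head?_nil, Option.isSome_none, Bool.false_eq_true, ite_false]
      exact runs_nop _
    · simp only [Reg.hasAux, List.head?_cons, Option.isSome_some, if_true]
      refine .push ?_
      simp [Reg.getAux]
  have h₂ := runs_transfer (a := .t) (b := .m i) (by simp)
    ⟨some (.sign b (τ.lit fl μ d).2), none, true, (τ.lit fl μ d).1⟩ inp
    (update (update (update (update S .fa w) .fb (.sign b (τ.lit fl μ d).2 :: a.fb))
      (.m i) a.m.tail) .t (a.m.head?.toList ++ a.t))
  have h₃ : (a.m.head?.toList ++ a.t).reverse ++ a.m.tail = a.t.reverse ++ a.m := by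
    rcases a with ⟨_, _ | ⟨c, m⟩, _, _, _⟩ <;> simp
  have h₄ : (a.m.head?.toList ++ a.t).length ≤ n := by
    refine le_trans ?_ hn
    rw [← h₃]
    simp only [List.length_append, List.length_reverse]
    omega
  refine (Runs.seq (B := 1) (.pop ?_) (Runs.seq h₁ (Runs.seq (B := 1) (.load rfl)
    (Runs.seq (B := 1) (.push rfl) ?_)))).mono (B := 1 + (1 + 1 + (1 + (1 + (3 * n + 2)))))
    (by omega)
  · simp only [Comparison.mem, Reg.setAux, Memory.mk.injEq, true_and]
    refine ⟨by simp, ?_⟩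
    funext k
    simp only [Function.update_apply]
    split_ifs <;> simp_all
  · simp only [Reg.applyLit, hd, Reg.getCur, Option.getD_some]
    have h₅ : update (update (update (update (update S .fa w) .fb a.fb) (.m i) a.m.tail) .t
          (a.m.head?.toList ++ a.t)) .fb (.sign b (τ.lit fl μ d).2 ::
          update (update (update (update S .fa w) .fb a.fb) (.m i) a.m.tail) .t
          (a.m.head?.toList ++ a.t) .fb) =
        update (update (update (update S .fa w) .fb (.sign b (τ.lit fl μ d).2 :: a.fb))
          (.m i) a.m.tail) .t (a.m.head?.toList ++ a.t) := by
      funext k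
      simp only [Function.update_apply]
      split_ifs <;> simp_all
    rw [h₅]
    have h₆ : update (update (update (update (update (update S .fa w) .fb
        (.sign b (τ.lit fl μ d).2 :: a.fb))
        (.m i) a.m.tail) .t (a.m.head?.toList ++ a.t)) .t []) (.m i)
        ((a.m.head?.toList ++ a.t).reverse ++ a.m.tail) =
        update (update (update (update S .fa w) .fb (.sign b (τ.lit fl μ d).2 :: a.fb)) (.m i)
          (a.t.reverse ++ a.m)) .t [] := by
      rw [h₃]
      funext k
      simp only [Function.update_apply]
      split_ifs <;> simp_all
    simp only [Function.update_self, ne_eq, reduceCtorEq, not_false_eq_true,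
      Function.update_of_ne] at h₂ h₆
    rw [h₆] at h₂
    exact h₂.mono (by omega)

/-- The memory between two items in a pass. -/
def passMem (inp : List Symbol) (S : Stk → List Cell) (a : Flags × List Cell) (is : List Item) :
    Mem :=
  ⟨(Reg.rest a.1).setCur (encodeItems is).head?, inp,
    update (update S .fa (encodeItems is).tail) .fb a.2⟩

theorem runs_itemStep (i : Fin 4) (τ : Transducer) (inp : List Symbol) (S : Stk → List Cell)
    (a : Flags × List Cell) (it : Item) (is : List Item) (m : Literal) (μ : Mark)
    (hm : S (.m i) = encodeMarked m μ) (ht : S .t = []) {n : ℕ}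
    (hn : (encodeMarked m μ).length ≤ n) (hit : it.encode.length ≤ n) :
    Runs (itemStep i τ) (passMem inp S a (it :: is))
      (passMem inp S ((τ.step m a.1 it).1, (τ.step m a.1 it).2.encode.reverse ++ a.2) is)
      (9 * n + 10) := by
  have base : ∀ (z : Cell) (w : List Cell), (⟨⟨some z, none, true, a.1⟩, inp,
      update (update S .fa w) .fb a.2⟩ : Mem) =
      Comparison.mem i a.1 inp S ⟨a.2, encodeMarked m μ, [], none, true⟩ (z :: w) := by
    intro z w
    simp only [Comparison.mem, Memory.mk.injEq, List.head?_cons, true_and, List.tail_cons]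
    funext k
    simp only [Function.update_apply]
    split_ifs <;> simp_all
  have base' : ∀ (bs : List Bool) (z : Cell) (w : List Cell),
      (⟨⟨(bs.map Cell.bit ++ z :: w).head?, none, true, a.1⟩, inp,
      update (update S .fa (bs.map Cell.bit ++ z :: w).tail) .fb a.2⟩ : Mem) =
      Comparison.mem i a.1 inp S ⟨a.2, encodeMarked m μ, [], none, true⟩
        (bs.map Cell.bit ++ z :: w) := by
    intro bs z w
    cases bs <;> exact base _ _
  cases it with
  | lit l ν =>
    have h₁ := runs_compareBits i a.1 inp S ⟨a.2, encodeMarked m μ, [], none, true⟩ l.1.reverse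
      (.sign l.2 ν) (by simp) (encodeItems is)
    have h₂ := runs_signStep i τ a.1 inp S
      (l.1.reverse.foldl Comparison.step ⟨a.2, encodeMarked m μ, [], none, true⟩) l.2 ν
      (encodeItems is) _ (compare_eq (m := m) (μ := μ) rfl rfl rfl) (n := n)
      (by rw [Comparison.foldl_t]; simpa using hn)
    rw [Comparison.foldl_t, Comparison.foldl_fb] at h₂
    have hlen : l.1.reverse.length + 1 ≤ n := by
      simpa [Item.encode, encodeMarked] using hit
    have h₃ : passMem inp S a (.lit l ν :: is) = Comparison.mem i a.1 inp S
        ⟨a.2, encodeMarked m μ, [], none, true⟩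
        (l.1.reverse.map Cell.bit ++ .sign l.2 ν :: encodeItems is) := by
      rw [← base']
      simp [passMem, encodeItems, Item.encode, encodeMarked, Reg.setCur, Reg.rest]
    rw [h₃]
    refine (Runs.seq h₁ (Runs.seq (Runs.ite (s' := ⟨Reg.rest (τ.lit a.1 ν (compareLiteral m l)).1,
        inp, update (update (update (update S .fa (encodeItems is)) .fb
          (.sign l.2 (τ.lit a.1 ν (compareLiteral m l)).2 :: ((l.1.reverse.map Cell.bit).reverse ++
            a.2))) (.m i) (encodeMarked m μ)) .t []⟩) ?_)
        (Runs.pop (s' := passMem inp S _ is) ?_))).mono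
      (B := 6 * l.1.reverse.length + 1 + (1 + (3 * n + 7) + 1)) (by omega)
    · exact h₂
    · simp only [passMem, Transducer.step, Memory.mk.injEq, Reg.setCur, Item.encode, encodeMarked]
      refine ⟨by simp [Reg.rest], trivial, ?_⟩
      funext k
      simp only [Function.update_apply]
      split_ifs <;> simp_all [encodeMarked]
  | fin e =>
    have h₁ := runs_compareBits i a.1 inp S ⟨a.2, encodeMarked m μ, [], none, true⟩ []
      (.fin e) (by simp) (encodeItems is)
    have h₃ : passMem inp S a (.fin e :: is) = Comparison.mem i a.1 inp S
        ⟨a.2, encodeMarked m μ, [], none, true⟩ (.fin e :: encodeItems is) := by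
      rw [← base]
      simp [passMem, encodeItems, Item.encode, Reg.setCur, Reg.rest]
    rw [h₃]
    refine (Runs.seq h₁ (Runs.seq (Runs.ite (B := 2)
      (s' := ⟨⟨some (.fin (τ.fin a.1 e).2), none, true, (τ.fin a.1 e).1⟩, inp,
        update (update S .fa (encodeItems is)) .fb (.fin (τ.fin a.1 e).2 :: a.2)⟩) ?_)
      (Runs.pop (s' := passMem inp S _ is) ?_))).mono
      (B := 6 * 0 + 1 + (1 + 2 + 1)) (by omega)
    · change Runs (finStep τ) _ _ 2
      simp only [List.foldl_nil]
      rw [← base]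
      refine Runs.seq (B := 1) (B' := 1) (.load rfl) (.push ?_)
      simp [Reg.applyFin, Reg.getCur]
    · simp only [passMem, Transducer.step, Memory.mk.injEq, Reg.setCur, Item.encode]
      refine ⟨by simp [Reg.rest], trivial, ?_⟩
      funext k
      simp only [Function.update_apply]
      split_ifs <;> simp_all

theorem Transducer.foldl_step (τ : Transducer) (m : Literal) (is : List Item)
    (a : Flags × List Cell) :
    is.foldl (fun a it => ((τ.step m a.1 it).1, (τ.step m a.1 it).2.encode.reverse ++ a.2)) a =
      ((τ.run m a.1 is).1, (encodeItems (τ.run m a.1 is).2).reverse ++ a.2) := by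
  induction is generalizing a with
  | nil => simp [run, encodeItems]
  | cons it is ih =>
    rw [List.foldl_cons, ih]
    simp [run, encodeItems]

theorem Item.length_encode_pos (it : Item) : 0 < it.encode.length := by
  cases it <;> simp [encode, encodeMarked]

theorem length_le_encodeItems (is : List Item) : is.length ≤ (encodeItems is).length := by
  induction is with
  | nil => simp
  | cons it is ih =>
    have := it.length_encode_pos
    simp only [encodeItems, List.flatMap_cons, List.length_append, List.length_cons] at ih ⊢
    omega

theorem length_encode_le_encodeItems {it : Item} {is : List Item} (h : it ∈ is) :
    it.encode.length ≤ (encodeItems is).length := by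
  induction is with
  | nil => simp at h
  | cons it' is ih =>
    simp only [encodeItems, List.flatMap_cons, List.length_append] at ih ⊢
    rcases List.mem_cons.1 h with rfl | h
    · omega
    · have := ih h
      omega

/-- A mark or a tag is a component of a single cell, so changing it costs no space. This keeps one
bound `n` valid through all nested loops. -/
theorem Transducer.length_encodeItems_run (τ : Transducer) (m : Literal) (fl : Flags)
    (is : List Item) : (encodeItems (τ.run m fl is).2).length = (encodeItems is).length := by
  induction is generalizing fl with
  | nil => rfl
  | cons it is ih =>
    have := ih (τ.step m fl it).1
    simp only [run, encodeItems, List.flatMap_cons, List.length_append] at this ⊢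
    rw [this]
    cases it <;> simp [step, Item.encode, encodeMarked]

/-- Processed items pile up in reverse on `fb`, and the final transfer puts them back in order.
There are at most `n` items, each costing at most `9 * n + 10` steps apart from the loop test. -/
theorem runs_pass (i : Fin 4) (τ : Transducer) (fl : Flags) (inp : List Symbol)
    (S : Stk → List Cell) (is : List Item) (m : Literal) (μ : Mark)
    (hm : S (.m i) = encodeMarked m μ) (ht : S .t = []) (hb : S .fb = [])
    (ha : S .fa = encodeItems is) {n : ℕ}
    (hn : (encodeMarked m μ).length ≤ n) (his : (encodeItems is).length ≤ n) :
    Runs (pass i τ) ⟨Reg.rest fl, inp, S⟩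
      ⟨Reg.rest (τ.run m fl is).1, inp, update S .fa (encodeItems (τ.run m fl is).2)⟩
      (n * (9 * n + 14) + 4) := by
  have h₁ := Runs.loop_list (b := Reg.hasCur) (p := itemStep i τ) is (passMem inp S)
    (fun a it => ((τ.step m a.1 it).1, (τ.step m a.1 it).2.encode.reverse ++ a.2))
    (fun _ => True) (B := 9 * n + 10)
    (fun _ _ => rfl)
    (fun a it ys _ _ => by
      have := it.length_encode_pos
      rcases h : it.encode with _ | ⟨c, w⟩
      · simp [h] at this
      · simp [passMem, encodeItems, h, Reg.hasCur, Reg.setCur])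
    (fun a it ys _ hit => runs_itemStep i τ inp S a it ys m μ hm ht hn
      ((length_encode_le_encodeItems hit).trans his))
    (fun _ _ _ _ => trivial) (fl, []) trivial
  rw [Transducer.foldl_step] at h₁
  have h₂ := runs_transfer (a := .fb) (b := .fa) (by simp) (Reg.rest (τ.run m fl is).1) inp
    (update (update S .fa []) .fb (encodeItems (τ.run m fl is).2).reverse)
  have h₃ : is.length * (9 * n + 10 + 1) ≤ n * (9 * n + 10 + 1) :=
    Nat.mul_le_mul_right _ ((length_le_encodeItems is).trans his)
  have h₄ := τ.length_encodeItems_run m fl is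
  refine (Runs.seq (B := 1) (.pop ?_) (Runs.seq h₁ ?_)).mono
    (B := 1 + (is.length * (9 * n + 10 + 1) + 1 + (3 * n + 2))) (by nlinarith)
  · simp only [passMem, Memory.mk.injEq, Reg.rest, ha, true_and]
    funext k
    simp only [Function.update_apply]
    split_ifs <;> simp_all
  · have h₅ : passMem inp S ((τ.run m fl is).1, (encodeItems (τ.run m fl is).2).reverse ++ []) [] =
        ⟨Reg.rest (τ.run m fl is).1, inp,
          update (update S .fa []) .fb (encodeItems (τ.run m fl is).2).reverse⟩ := by
      simp [passMem, encodeItems, Reg.setCur, Reg.rest]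
    rw [h₅]
    have h₆ : update (update (update (update S .fa []) .fb
        (encodeItems (τ.run m fl is).2).reverse) .fb []) .fa
        (encodeItems (τ.run m fl is).2) = update S .fa (encodeItems (τ.run m fl is).2) := by
      funext k
      simp only [Function.update_apply]
      split_ifs <;> simp_all
    simp only [Function.update_self, ne_eq, reduceCtorEq, not_false_eq_true,
      Function.update_of_ne, List.reverse_reverse, List.append_nil, List.length_reverse] at h₂
    rw [h₆] at h₂
    exact h₂.mono (by omega)

/-! ### Loops over literals and a calculus of specifications -/

/-- The word that represents a list of literals. -/
def encodeLits (ls : List Literal) : List Cell := ls.flatMap fun l => encodeMarked l .unset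

/-- Move a literal from the stack `x i` to `y i` and copy it to `m i`. -/
def fetch (i : Fin 4) : Program :=
  .seq (.loop Reg.isBit (.seq (.push (.y i) Reg.getCur) (.seq (.push .t Reg.getCur)
      (.pop (.x i) Reg.setCur))))
    (.seq (.push (.y i) Reg.getCur) (.seq (.push .t Reg.getCur) (transfer .t (.m i))))

/-- Run a program for every literal on the stack `x i`, with the literal on `m i`. -/
def forEach (i : Fin 4) (body : Program) : Program :=
  .seq (.pop (.x i) Reg.setCur) (.seq
    (.loop Reg.hasCur (.seq (fetch i) (.seq body (.seq (clear (.m i)) (.pop (.x i) Reg.setCur)))))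
    (transfer (.y i) (.x i)))

theorem runs_fetch (i : Fin 4) (fl : Flags) (inp : List Symbol) (S : Stk → List Cell)
    (l : Literal) (w : List Cell) (ht : S .t = []) (hm : S (.m i) = []) :
    Runs (fetch i)
      ⟨(Reg.rest fl).setCur (encodeMarked l .unset ++ w).head?, inp,
        update S (.x i) (encodeMarked l .unset ++ w).tail⟩
      ⟨Reg.rest fl, inp, update (update (update S (.x i) w) (.y i)
        ((encodeMarked l .unset).reverse ++ S (.y i))) (.m i) (encodeMarked l .unset)⟩
      (7 * (encodeMarked l .unset).length + 5) := by
  have h₁ := Runs.loop_list (b := Reg.isBit) (p := Prog.seq (I := Symbol) (.push (.y i) Reg.getCur)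
      (.seq (.push .t Reg.getCur) (.pop (.x i) Reg.setCur))) l.1.reverse
    (fun (a : List Cell × List Cell) ys =>
      ⟨(Reg.rest fl).setCur (ys.map Cell.bit ++ .sign l.2 .unset :: w).head?, inp,
        update (update (update S (.x i) (ys.map Cell.bit ++ .sign l.2 .unset :: w).tail) (.y i)
          a.1) .t a.2⟩)
    (fun a b => (.bit b :: a.1, .bit b :: a.2)) (fun _ => True) (B := 3)
    (fun _ _ => rfl) (fun _ _ _ _ _ => rfl)
    (fun a b ys _ _ => by
      refine Runs.seq (B := 1) (B' := 2) (.push rfl) (Runs.seq (B := 1) (B' := 1) (.push rfl)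
        (.pop ?_))
      simp only [Reg.setCur, Reg.getCur, Memory.mk.injEq, true_and]
      refine ⟨by simp, ?_⟩
      funext k
      simp only [Function.update_apply]
      split_ifs <;> simp_all)
    (fun _ _ _ _ => trivial) (S (.y i), []) trivial
  have h₂ : ∀ (bs : List Bool) (a : List Cell × List Cell),
      bs.foldl (fun a b => (Cell.bit b :: a.1, Cell.bit b :: a.2)) a =
        ((bs.map Cell.bit).reverse ++ a.1, (bs.map Cell.bit).reverse ++ a.2) := by
    intro bs
    induction bs with
    | nil => simp
    | cons b bs ih => intro a; simp [ih]
  rw [h₂] at h₁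
  have h₃ := runs_transfer (a := .t) (b := .m i) (by simp)
    ⟨some (.sign l.2 .unset), none, true, fl⟩ inp
    (update (update (update S (.x i) w) (.y i) ((encodeMarked l .unset).reverse ++ S (.y i))) .t
      (encodeMarked l .unset).reverse)
  have h₄ : update (update (update (update (update S (.x i) w) (.y i)
      ((encodeMarked l .unset).reverse ++ S (.y i))) .t
      (encodeMarked l .unset).reverse) .t []) (.m i) (encodeMarked l .unset) =
      update (update (update S (.x i) w) (.y i)
        ((encodeMarked l .unset).reverse ++ S (.y i))) (.m i) (encodeMarked l .unset) := by
    funext k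
    simp only [Function.update_apply]
    split_ifs <;> simp_all
  simp only [Function.update_self, ne_eq, reduceCtorEq, not_false_eq_true,
    Function.update_of_ne, hm, List.reverse_reverse, List.append_nil, List.length_reverse] at h₃
  rw [h₄] at h₃
  have h₅ : l.1.reverse.length + 1 = (encodeMarked l .unset).length := by
    simp [encodeMarked]
  have h₆ : encodeMarked l .unset ++ w = l.1.reverse.map Cell.bit ++ .sign l.2 .unset :: w := by
    simp [encodeMarked]
  have h₇ : update S (.x i) (encodeMarked l .unset ++ w).tail = update (update (update S (.x i)
      (l.1.reverse.map Cell.bit ++ .sign l.2 .unset :: w).tail) (.y i) (S (.y i))) .t [] := by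
    rw [h₆]
    funext k
    simp only [Function.update_apply]
    split_ifs <;> simp_all
  rw [h₇, h₆]
  refine (Runs.seq h₁ (Runs.seq (B := 1) (.push rfl) (Runs.seq (B := 1) (.push ?_) h₃))).mono
    (by omega)
  simp only [Reg.getCur, Memory.mk.injEq, Reg.rest, Reg.setCur]
  refine ⟨rfl, trivial, ?_⟩
  funext k
  simp only [Function.update_apply]
  split_ifs <;> simp_all [encodeMarked]

/-- `Implements p ok g n B`: if the stacks satisfy `ok`, then `p` changes the flags and the items
of the formula as `g` does, and nothing else, in at most `B` steps, where `n` bounds the size of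
the formula. -/
def Implements (p : Program) (ok : (Stk → List Cell) → Prop)
    (g : Flags × List Item → Flags × List Item) (n B : ℕ) : Prop :=
  ∀ (S : Stk → List Cell) (a : Flags × List Item), ok S → S .fb = [] → S .t = [] →
    S .fa = encodeItems a.2 → (encodeItems a.2).length ≤ n →
      Runs p ⟨Reg.rest a.1, [], S⟩ ⟨Reg.rest (g a).1, [], update S .fa (encodeItems (g a).2)⟩ B ∧
        (encodeItems (g a).2).length ≤ n

theorem Implements.seq {p q : Program} {ok : (Stk → List Cell) → Prop}
    {g g' : Flags × List Item → Flags × List Item} {n B B' : ℕ}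
    (hok : ∀ S w, ok S → ok (update S .fa w)) (hp : Implements p ok g n B)
    (hq : Implements q ok g' n B') :
    Implements (.seq p q) ok (fun a => g' (g a)) n (B + B') := by
  intro S a hS hb ht ha hn
  obtain ⟨h₁, h₂⟩ := hp S a hS hb ht ha hn
  obtain ⟨h₃, h₄⟩ := hq (update S .fa (encodeItems (g a).2)) (g a) (hok _ _ hS) (by simpa using hb)
    (by simpa using ht) (by simp) h₂
  rw [Function.update_idem] at h₃
  exact ⟨h₁.seq h₃, h₄⟩

theorem Implements.mono {p : Program} {ok ok' : (Stk → List Cell) → Prop}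
    {g g' : Flags × List Item → Flags × List Item} {n B B' : ℕ} (hp : Implements p ok g n B)
    (hok : ∀ S, ok' S → ok S) (hg : ∀ a, g a = g' a) (hB : B ≤ B') : Implements p ok' g' n B' := by
  obtain rfl : g = g' := funext hg
  intro S a hS hb ht ha hn
  obtain ⟨h₁, h₂⟩ := hp S a (hok S hS) hb ht ha hn
  exact ⟨h₁.mono hB, h₂⟩

theorem implements_pass (i : Fin 4) (τ : Transducer) (m : Literal) {n : ℕ}
    (hn : (encodeMarked m .unset).length ≤ n) :
    Implements (pass i τ) (fun S => S (.m i) = encodeMarked m .unset)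
      (fun a => τ.run m a.1 a.2) n (n * (9 * n + 14) + 4) := by
  intro S a hm hb ht ha his
  exact ⟨runs_pass i τ a.1 [] S a.2 m .unset hm ht hb ha hn his,
    by rwa [τ.length_encodeItems_run]⟩

theorem implements_load (f : Flags → Flags) (ok : (Stk → List Cell) → Prop) (n : ℕ) :
    Implements (.load fun r => Reg.rest (f r.fl)) ok (fun a => (f a.1, a.2)) n 1 := by
  intro S a _ _ _ ha hn
  refine ⟨.load ?_, hn⟩
  simp [Reg.rest, ← ha]

/-- The loops inside of loop `i` are ready to run through the list `V`. -/
def Ready (V : List Literal) (i : Fin 4) (S : Stk → List Cell) : Prop :=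
  ∀ k : Fin 4, i < k → S (.x k) = encodeLits V ∧ S (.y k) = [] ∧ S (.m k) = []

/-- Inside of loop `i`, with the literal `l`. -/
def Inside (V : List Literal) (i : Fin 4) (l : Literal) (S : Stk → List Cell) : Prop :=
  Ready V i S ∧ S (.m i) = encodeMarked l .unset

/-- Before loop `i` over the list `ls`. -/
def Before (V : List Literal) (i : Fin 4) (ls : List Literal) (S : Stk → List Cell) : Prop :=
  Ready V i S ∧ S (.x i) = encodeLits ls ∧ S (.y i) = [] ∧ S (.m i) = []

theorem Ready.update {V : List Literal} {i : Fin 4} {S : Stk → List Cell} (h : Ready V i S)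
    {s : Stk} (hs : ∀ k, i < k → .x k ≠ s ∧ .y k ≠ s ∧ .m k ≠ s) (w : List Cell) :
    Ready V i (update S s w) := by
  intro k hk
  obtain ⟨h₁, h₂, h₃⟩ := hs k hk
  rw [Function.update_of_ne h₁, Function.update_of_ne h₂, Function.update_of_ne h₃]
  exact h k hk

theorem Inside.update_fa {V : List Literal} {i : Fin 4} {l : Literal} {S : Stk → List Cell}
    (h : Inside V i l S) (w : List Cell) : Inside V i l (update S .fa w) :=
  ⟨h.1.update (by simp) w, by simpa using h.2⟩

theorem Before.update_fa {V : List Literal} {i : Fin 4} {ls : List Literal} {S : Stk → List Cell}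
    (h : Before V i ls S) (w : List Cell) : Before V i ls (update S .fa w) :=
  ⟨h.1.update (by simp) w, by simpa using h.2⟩

theorem length_le_encodeLits (ls : List Literal) : ls.length ≤ (encodeLits ls).length := by
  induction ls with
  | nil => simp
  | cons l ls ih =>
    simp only [encodeLits, List.flatMap_cons, List.length_append, List.length_cons,
      encodeMarked] at ih ⊢
    simp only [List.length_nil]
    omega

theorem length_encodeMarked_le_encodeLits {l : Literal} {ls : List Literal} (h : l ∈ ls) :
    (encodeMarked l .unset).length ≤ (encodeLits ls).length := by
  induction ls with
  | nil => simp at h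
  | cons l' ls ih =>
    simp only [encodeLits, List.flatMap_cons, List.length_append] at ih ⊢
    rcases List.mem_cons.1 h with rfl | h
    · omega
    · have := ih h
      omega

/-- The literals that are done are collected on `y i` and moved back at the end, so the loop leaves
its own list intact and can be run again by an enclosing loop. -/
theorem implements_forEach {V : List Literal} {i : Fin 4} {ls : List Literal} {body : Program}
    {g : Flags × List Item → Literal → Flags × List Item} {n B : ℕ}
    (hls : (encodeLits ls).length ≤ n)
    (hbody : ∀ l ∈ ls, Implements body (Inside V i l) (fun a => g a l) n B) :
    Implements (forEach i body) (Before V i ls) (fun a => ls.foldl g a) n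
      (n * (B + 9 * n + 9) + 3 * n + 4) := by
  rintro S a ⟨hr, hx, hy, hm⟩ hb ht ha hn
  have h₁ := Runs.loop_list (b := Reg.hasCur) (p := Prog.seq (fetch i)
      (.seq body (.seq (clear (.m i)) (.pop (.x i) Reg.setCur)))) ls
    (fun (a : (Flags × List Item) × List Cell) ys =>
      ⟨(Reg.rest a.1.1).setCur (encodeLits ys).head?, [],
        update (update (update S .fa (encodeItems a.1.2)) (.y i) a.2) (.x i)
          (encodeLits ys).tail⟩)
    (fun a l => (g a.1 l, (encodeMarked l .unset).reverse ++ a.2))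
    (fun a => (encodeItems a.1.2).length ≤ n) (B := B + 9 * n + 8)
    (fun _ _ => rfl)
    (fun a l ys _ _ => by
      have : 0 < (encodeMarked l .unset).length := by simp [encodeMarked]
      rcases h : encodeMarked l .unset with _ | ⟨c, w⟩
      · simp [h] at this
      · simp [encodeLits, h, Reg.hasCur, Reg.setCur])
    (fun a l ys hna hl => by
      have hln := (length_encodeMarked_le_encodeLits hl).trans hls
      have h₁ := runs_fetch i a.1.1 [] (update (update S .fa (encodeItems a.1.2)) (.y i) a.2) l
        (encodeLits ys) (by simpa using ht) (by simpa using hm)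
      obtain ⟨h₂, -⟩ := hbody l hl (update (update (update (update (update S .fa
        (encodeItems a.1.2)) (.y i) a.2) (.x i) (encodeLits ys)) (.y i)
        ((encodeMarked l .unset).reverse ++ a.2)) (.m i) (encodeMarked l .unset)) a.1
        ⟨by
          refine Ready.update (Ready.update (Ready.update (Ready.update (Ready.update hr
            ?_ _) ?_ _) ?_ _) ?_ _) ?_ _ <;> simp +contextual [ne_of_gt],
          by simp⟩ (by simpa using hb) (by simpa using ht) (by simp) hna
      rw [show update (update S .fa (encodeItems a.1.2)) (.y i) a.2 (.y i) = a.2 by simp] at h₁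
      refine (Runs.seq h₁ (Runs.seq h₂ (Runs.seq (runs_clear _ _ _ _)
        (Runs.pop (s' := _) ?_)))).mono ?_
      · simp only [Memory.mk.injEq, Reg.setCur, Reg.rest, true_and]
        refine ⟨by simp, ?_⟩
        funext k
        simp only [Function.update_apply]
        split_ifs <;> simp_all
      · simp only [ne_eq, reduceCtorEq, not_false_eq_true, Function.update_of_ne,
          Function.update_self]
        omega)
    -- The length bound in `Implements` does not involve the stacks; any stack contents that meet
    -- its hypotheses serve to extract it.
    (fun a l hna hl => by
      obtain ⟨-, h⟩ := hbody l hl (update (update (update S .fa (encodeItems a.1.2)) .t [])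
        (.m i) (encodeMarked l .unset)) a.1
        ⟨by
          refine Ready.update (Ready.update (Ready.update hr ?_ _) ?_ _) ?_ _ <;>
            simp +contextual [ne_of_gt],
          by simp⟩ (by simpa using hb) (by simp) (by simp) hna
      exact h) (a, []) hn
  have h₂ : ∀ (ls : List Literal) (a : (Flags × List Item) × List Cell),
      ls.foldl (fun a l => (g a.1 l, (encodeMarked l .unset).reverse ++ a.2)) a =
        (ls.foldl g a.1, (encodeLits ls).reverse ++ a.2) := by
    intro ls
    induction ls with
    | nil => simp [encodeLits]
    | cons l ls ih => intro a; simp [ih, encodeLits]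
  have hinv : ∀ (ls' : List Literal), (∀ l ∈ ls', l ∈ ls) → ∀ a : Flags × List Item,
      (encodeItems a.2).length ≤ n → (encodeItems (ls'.foldl g a).2).length ≤ n := by
    intro ls'
    induction ls' with
    | nil => exact fun _ a h => h
    | cons l ls' ih =>
      intro hl a hna
      refine ih (fun l' hl' => hl l' (by simp [hl'])) _ ?_
      obtain ⟨-, h⟩ := hbody l (hl l (by simp)) (update (update (update S .fa (encodeItems a.2))
        .t []) (.m i) (encodeMarked l .unset)) a
        ⟨by
          refine Ready.update (Ready.update (Ready.update hr ?_ _) ?_ _) ?_ _ <;>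
            simp +contextual [ne_of_gt],
          by simp⟩ (by simpa using hb) (by simp) (by simp) hna
      exact h
  refine ⟨?_, hinv ls (fun _ h => h) a hn⟩
  rw [h₂] at h₁
  have h₃ := runs_transfer (a := .y i) (b := .x i) (by simp) (Reg.rest (ls.foldl g a).1) []
    (update (update (update S .fa (encodeItems (ls.foldl g a).2)) (.y i)
      (encodeLits ls).reverse) (.x i) [])
  have h₄ : update (update (update (update (update S .fa (encodeItems (ls.foldl g a).2)) (.y i)
      (encodeLits ls).reverse) (.x i) []) (.y i) []) (.x i) (encodeLits ls) =
      update S .fa (encodeItems (ls.foldl g a).2) := by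
    funext k
    simp only [Function.update_apply]
    split_ifs <;> simp_all
  simp only [Function.update_self, ne_eq, reduceCtorEq, not_false_eq_true,
    Function.update_of_ne, List.reverse_reverse, List.append_nil, List.length_reverse] at h₃
  rw [h₄] at h₃
  have h₅ : ls.length * (B + 9 * n + 8 + 1) ≤ n * (B + 9 * n + 9) :=
    Nat.mul_le_mul_right _ ((length_le_encodeLits ls).trans hls)
  refine (Runs.seq (B := 1) (.pop ?_) (Runs.seq h₁ ?_)).mono
    (B := 1 + (ls.length * (B + 9 * n + 8 + 1) + 1 + (3 * n + 2))) (by omega)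
  · simp only [Memory.mk.injEq, Reg.rest, Reg.setCur, hx, true_and]
    funext k
    simp only [Function.update_apply]
    split_ifs <;> simp_all
  · rw [List.append_nil]
    exact h₃.mono (by omega)

/-! ### Reading the input and cleaning up -/

/-- The cell that represents an input symbol. -/
def toCell : Symbol → Cell
  | .bit b => .bit b
  | .sign b => .sign b .unset
  | .endClause => .fin ⟨false, false, false, false⟩

def Reg.setSymbol (r : Reg) (s : Option Symbol) : Reg := { r with cur := s.map toCell }

def Reg.hasLiteralCell (r : Reg) : Bool :=
  match r.cur with
  | some (.bit _) => true
  | some (.sign _ _) => true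
  | _ => false

/-- Is the symbol a part of a literal? -/
def isLiteralSymbol : Symbol → Bool
  | .endClause => false
  | _ => true

/-- Read the clause to be checked. -/
def readClause : Program :=
  .seq (.read Reg.setSymbol) (.seq (.loop Reg.hasLiteralCell
    (.seq (.push (.x 0) Reg.getCur) (.read Reg.setSymbol))) (.push .fa Reg.getCur))

/-- Read the formula. -/
def readFormula : Program :=
  .seq (.read Reg.setSymbol) (.seq (.loop Reg.hasCur (.seq (.push .fa Reg.getCur)
    (.seq (.ite Reg.hasLiteralCell (.seq (.push (.x 1) Reg.getCur) (.seq (.push (.x 2) Reg.getCur)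
      -- The final pop discards the end marker of the last clause. On the stack every other marker
      -- then ends the clause that was read after it, and the marker of the clause to be checked, at
      -- the bottom, ends the clause that was read first.
      (.push (.x 3) Reg.getCur))) nop) (.read Reg.setSymbol)))) (.pop .fa Reg.setAux))

theorem hasLiteralCell_setSymbol (r : Reg) (s : Symbol) :
    (r.setSymbol (some s)).hasLiteralCell = isLiteralSymbol s := by
  cases s <;> rfl

theorem runs_readClause (r : Reg) (w w' : List Symbol) (hw : ∀ s ∈ w, isLiteralSymbol s = true)
    (S : Stk → List Cell) :
    Runs readClause ⟨r, w ++ .endClause :: w', S⟩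
      ⟨r.setSymbol (some .endClause), w', update (update S (.x 0) ((w.map toCell).reverse ++ S (.x 0)))
        .fa (toCell .endClause :: S .fa)⟩ (3 * w.length + 3) := by
  have h₁ := Runs.loop_list (b := Reg.hasLiteralCell)
    (p := Prog.seq (.push (.x 0) Reg.getCur) (.read Reg.setSymbol)) w
    (fun (a : List Cell) ys => (⟨r.setSymbol (ys ++ .endClause :: w').head?,
      (ys ++ .endClause :: w').tail, update S (.x 0) a⟩ : Mem))
    (fun a s => toCell s :: a) (fun _ => True) (B := 2)
    (fun _ _ => rfl)
    (fun a s ys _ hs => by simp [hasLiteralCell_setSymbol, hw s hs])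
    (fun a s ys _ hs => by
      refine Runs.seq (B := 1) (B' := 1) (.push rfl) (.read ?_)
      simp [Reg.setSymbol, Reg.getCur])
    (fun _ _ _ _ => trivial) (S (.x 0)) trivial
  have h₂ : ∀ (w : List Symbol) (a : List Cell),
      w.foldl (fun a s => toCell s :: a) a = (w.map toCell).reverse ++ a := by
    intro w
    induction w with
    | nil => simp
    | cons s w ih => intro a; simp [ih]
  rw [h₂] at h₁
  refine (Runs.seq (B := 1) (.read ?_) (Runs.seq h₁ (Runs.push ?_))).mono
    (B := 1 + (w.length * (2 + 1) + 1 + 1)) (by omega)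
  · simp [Reg.setSymbol]
  · simp [Reg.setSymbol, Reg.getCur]

/-- The memory while the formula is read. -/
def readMem (r : Reg) (S : Stk → List Cell) (a : List Cell × List Cell) (w : List Symbol) : Mem :=
  ⟨r.setSymbol w.head?, w.tail,
    update (update (update (update S .fa a.1) (.x 1) a.2) (.x 2) a.2) (.x 3) a.2⟩

/-- Only the flags of the final register matter, since the rest is reset before the main program
starts. The literals are stored three times, once for each of the nested loops `1`, `2`, `3`. -/
theorem runs_readFormula (r : Reg) (w : List Symbol) (S : Stk → List Cell)
    (hx₁ : S (.x 1) = []) (hx₂ : S (.x 2) = []) (hx₃ : S (.x 3) = []) :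
    ∃ r', r'.fl = r.fl ∧ Runs readFormula ⟨r, w, S⟩
      ⟨r', [], update (update (update (update S .fa ((w.map toCell).reverse ++ S .fa).tail)
        (.x 1) ((w.filter isLiteralSymbol).map toCell).reverse)
        (.x 2) ((w.filter isLiteralSymbol).map toCell).reverse)
        (.x 3) ((w.filter isLiteralSymbol).map toCell).reverse⟩ (7 * w.length + 3) := by
  have h₁ := Runs.loop_list (b := Reg.hasCur)
    (p := (.seq (.push .fa Reg.getCur)
    (.seq (.ite Reg.hasLiteralCell (.seq (.push (.x 1) Reg.getCur) (.seq (.push (.x 2) Reg.getCur)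
      (.push (.x 3) Reg.getCur))) nop) (.read Reg.setSymbol)) : Program)) w
    (readMem r S)
    (fun a s => (toCell s :: a.1, if isLiteralSymbol s then toCell s :: a.2 else a.2))
    (fun _ => True) (B := 6)
    (fun _ _ => rfl) (fun _ _ _ _ _ => rfl)
    (fun a s ys _ hs => by
      refine (Runs.seq (B := 1) (.push rfl) (Runs.seq (B := 4) (B' := 1)
        (s' := ⟨r.setSymbol (some s), ys,
          update (update (update (update S .fa (toCell s :: a.1))
            (.x 1) (if isLiteralSymbol s then toCell s :: a.2 else a.2))
            (.x 2) (if isLiteralSymbol s then toCell s :: a.2 else a.2))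
            (.x 3) (if isLiteralSymbol s then toCell s :: a.2 else a.2)⟩)
        (Runs.ite (B := 3) ?_) (.read rfl)))
      simp only [readMem, List.head?_cons, hasLiteralCell_setSymbol]
      split_ifs with h
      · refine (Runs.seq (B := 1) (.push rfl) (Runs.seq (B := 1) (B' := 1) (.push rfl) (.push ?_)))
        simp only [Memory.mk.injEq, Reg.getCur, Reg.setSymbol, List.tail_cons, true_and]
        funext k
        cases k with
        | x i => fin_cases i <;> simp
        | _ => simp
      · refine (Runs.load (I := Symbol) (f := id) ?_).mono (by omega)
        simp only [Memory.mk.injEq, List.tail_cons, true_and, id, Reg.getCur, Reg.setSymbol]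
        funext k
        cases k with
        | x i => fin_cases i <;> simp
        | _ => simp)
    (fun _ _ _ _ => trivial) (S .fa, []) trivial
  have h₂ : ∀ (w : List Symbol) (a : List Cell × List Cell),
      w.foldl (fun a s => (toCell s :: a.1, if isLiteralSymbol s then toCell s :: a.2 else a.2)) a =
        ((w.map toCell).reverse ++ a.1, ((w.filter isLiteralSymbol).map toCell).reverse ++ a.2) := by
    intro w
    induction w with
    | nil => simp
    | cons s w ih =>
      intro a
      rw [List.foldl_cons, ih]
      by_cases h : isLiteralSymbol s <;> simp [h]
  rw [h₂] at h₁
  refine ⟨(r.setSymbol none).setAux ((w.map toCell).reverse ++ S .fa).head?, rfl,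
    (Runs.seq (B := 1) (.read ?_) (Runs.seq h₁ (Runs.pop ?_))).mono
      (B := 1 + (w.length * (6 + 1) + 1 + 1)) (by omega)⟩
  · simp only [readMem, Memory.mk.injEq, true_and]
    funext k
    cases k with
    | x i => fin_cases i <;> simp [hx₁, hx₂, hx₃]
    | _ => simp
  · simp only [readMem, Memory.mk.injEq, List.append_nil]
    refine ⟨by simp, rfl, ?_⟩
    funext k
    cases k with
    | x i => fin_cases i <;> simp
    | _ => simp

/-- The items of a formula. -/
def items (F : List (List Literal)) (ρ : Literal → Mark) (e : List Literal → Tag) : List Item :=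
  F.flatMap fun k => k.map (fun l => Item.lit l (ρ l)) ++ [Item.fin (e k)]

theorem reverse_map_encodeLiteral (k : List Literal) :
    ((k.flatMap encodeLiteral).map toCell).reverse = encodeLits k.reverse := by
  induction k with
  | nil => rfl
  | cons l k ih =>
    rw [List.flatMap_cons, List.map_append, List.reverse_append, ih, List.reverse_cons]
    simp only [encodeLits, List.flatMap_append, List.flatMap_cons, List.flatMap_nil,
      List.append_nil, encodeLiteral, encodeMarked, List.map_cons, List.reverse_cons, toCell,
      List.map_map, List.map_reverse]
    rfl

theorem encodeItems_append (is js : List Item) :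
    encodeItems (is ++ js) = encodeItems is ++ encodeItems js := by
  simp [encodeItems]

theorem encodeItems_lits (k : List Literal) :
    encodeItems (k.map fun l => Item.lit l .unset) = encodeLits k := by
  induction k with
  | nil => rfl
  | cons l k ih =>
    simp only [encodeItems, encodeLits, List.map_cons, List.flatMap_cons] at ih ⊢
    rw [ih]
    rfl

theorem items_append (F G : List (List Literal)) (ρ : Literal → Mark) (e : List Literal → Tag) :
    items (F ++ G) ρ e = items F ρ e ++ items G ρ e := by
  simp [items]

/-- Pushing reverses everything: the order of the clauses, of their literals and of the bits. With
the additional marker at the bottom, end markers in front of reversed clauses become end markers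
behind them, up to one on top. -/
theorem reverse_map_encodeClauses (F : List (List Literal)) :
    ((F.flatMap encodeClause).map toCell).reverse ++ [toCell .endClause] =
      toCell .endClause :: encodeItems (items (F.map List.reverse).reverse (fun _ => .unset)
        fun _ => ⟨false, false, false, false⟩) := by
  induction F with
  | nil => rfl
  | cons k F ih =>
    rw [List.flatMap_cons, List.map_append, List.reverse_append, encodeClause, List.map_append,
      List.reverse_append, reverse_map_encodeLiteral, List.map_cons (f := List.reverse),
      List.reverse_cons (as := F.map List.reverse), items_append, encodeItems_append, ← List.cons_append, ← ih]
    simp only [items, List.flatMap_cons, List.flatMap_nil, List.append_nil, encodeItems_append,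
      encodeItems_lits]
    simp [toCell, encodeItems, Item.encode]

theorem reverse_map_filter_encodeClauses (F : List (List Literal)) :
    (((F.flatMap encodeClause).filter isLiteralSymbol).map toCell).reverse =
      encodeLits (F.map List.reverse).reverse.flatten := by
  have h : ∀ k : List Literal, (k.flatMap encodeLiteral).filter isLiteralSymbol =
      k.flatMap encodeLiteral := by
    intro k
    rw [List.filter_eq_self]
    intro s hs
    obtain ⟨l, -, hl⟩ := List.mem_flatMap.1 hs
    rcases List.mem_cons.1 hl with rfl | hl
    · rfl
    · obtain ⟨b, -, rfl⟩ := List.mem_map.1 hl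
      rfl
  rw [← List.reverse_flatten, ← reverse_map_encodeLiteral]
  congr 2
  induction F with
  | nil => rfl
  | cons k F ih =>
    rw [List.flatMap_cons, List.filter_append, ih, encodeClause, List.filter_append, h]
    simp [isLiteralSymbol]

/-- Empty all stacks that are not empty between two subroutines. -/
def clearAll : Program :=
  .seq (clear .fa) (.seq (clear (.x 0)) (.seq (clear (.x 1)) (.seq (clear (.x 2)) (clear (.x 3)))))

theorem runs_clearAll (r : Reg) (S : Stk → List Cell) (hb : S .fb = []) (ht : S .t = [])
    (hy : ∀ i, S (.y i) = []) (hm : ∀ i, S (.m i) = []) {n : ℕ} (ha : (S .fa).length ≤ n)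
    (hx : ∀ i, (S (.x i)).length ≤ n) :
    Runs clearAll ⟨r, [], S⟩ ⟨r.setCur none, [], fun _ => []⟩ (10 * n + 10) := by
  have h := Runs.seq (runs_clear .fa r [] S) (Runs.seq (runs_clear (.x 0) _ _ _) (Runs.seq
    (runs_clear (.x 1) _ _ _) (Runs.seq (runs_clear (.x 2) _ _ _) ((runs_clear (.x 3) _ _ _)))))
  have hS : update (update (update (update (update S .fa []) (.x 0) []) (.x 1) []) (.x 2) [])
      (.x 3) [] = fun _ => [] := by
    funext k
    cases k with
    | x i => fin_cases i <;> simp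
    | fa => simp
    | fb => simpa using hb
    | t => simpa using ht
    | y i => simpa using hy i
    | m i => simpa using hm i
  rw [hS] at h
  refine h.mono ?_
  have h₀ := hx 0
  have h₁ := hx 1
  have h₂ := hx 2
  have h₃ := hx 3
  simp only [ne_eq, reduceCtorEq, not_false_eq_true, Function.update_of_ne, Stk.x.injEq,
    Fin.reduceEq]
  omega

/-- Decide a property of the input by running `p` on the formula. -/
def decider (p : Program) : Program :=
  .seq readClause (.seq readFormula (.seq (.load fun r => Reg.rest r.fl) (.seq p clearAll)))

theorem length_encodeClauses_le {C : Set Clause → Prop} (p : Input C) :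
    ((p.clause.flatMap encodeLiteral).length + (p.formula.flatMap encodeClause).length) + 1 =
      p.encode.length := by
  simp [Input.encode, encodeClause]
  omega

/-- A program that works on the formula in a number of steps that is bounded by a polynomial. -/
theorem nonempty_computableInPolyTime_of_implements {C : Set Clause → Prop} {f : Input C → Bool}
    (p : Program) (q : Polynomial ℕ)
    (g : List Literal → List (List Literal) → Flags × List Item → Flags × List Item)
    (hp : ∀ c F n, (encodeLits c).length ≤ n → (encodeLits F.flatten).length ≤ n →
      Implements p (Before F.flatten 0 c) (g c F) n (q.eval n))
    (hf : ∀ a : Input C, (g a.clause.reverse (a.formula.map List.reverse).reverse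
      (⟨false, false, false, false, false⟩, items (a.formula.map List.reverse).reverse
        (fun _ => .unset) fun _ => ⟨false, false, false, false⟩)).1.ans = f a) :
    Nonempty (Turing.TM2ComputableInPolyTime Input.encode Computability.encodeBool f) := by
  -- The linear term pays for reading the input, resetting the register and emptying the stacks.
  refine nonempty_computableInPolyTime (decider p) (Reg.rest ⟨false, false, false, false, false⟩)
    (fun r => r.fl.ans) (q + 20 * Polynomial.X + 20) fun a => ?_
  set c := a.clause.reverse with hc
  set F := (a.formula.map List.reverse).reverse with hF
  set n := a.encode.length with hn
  have hlen := length_encodeClauses_le a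
  have hlc : (encodeLits c).length ≤ n := by
    rw [hc, ← reverse_map_encodeLiteral, List.length_reverse, List.length_map]
    omega
  have hlF : (encodeLits F.flatten).length ≤ n := by
    rw [hF, ← reverse_map_filter_encodeClauses, List.length_reverse, List.length_map]
    have := List.length_filter_le isLiteralSymbol (a.formula.flatMap encodeClause)
    omega
  have hli : (encodeItems (items F (fun _ => .unset) fun _ => ⟨false, false, false, false⟩)).length
      ≤ n := by
    have := congrArg List.length (reverse_map_encodeClauses a.formula)
    rw [← hF] at this
    simp only [List.length_append, List.length_reverse, List.length_map, List.length_cons,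
      List.length_nil] at this
    omega
  have h₁ := runs_readClause (Reg.rest ⟨false, false, false, false, false⟩)
    (a.clause.flatMap encodeLiteral) (a.formula.flatMap encodeClause) (by
      intro s hs
      obtain ⟨l, -, hl⟩ := List.mem_flatMap.1 hs
      rcases List.mem_cons.1 hl with rfl | hl
      · rfl
      · obtain ⟨b, -, rfl⟩ := List.mem_map.1 hl
        rfl) (fun _ => [])
  have hinp : a.clause.flatMap encodeLiteral ++ .endClause :: a.formula.flatMap encodeClause =
      a.encode := by
    simp [Input.encode, encodeClause]
  rw [hinp, reverse_map_encodeLiteral, List.append_nil] at h₁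
  obtain ⟨r, hr, h₂⟩ := runs_readFormula
    ((Reg.rest ⟨false, false, false, false, false⟩).setSymbol (some .endClause))
    (a.formula.flatMap encodeClause) (update (update (fun _ => []) (.x 0) (encodeLits c))
        .fa [toCell .endClause]) (by simp) (by simp) (by simp)
  rw [Function.update_self, reverse_map_encodeClauses, List.tail_cons,
    reverse_map_filter_encodeClauses] at h₂
  set S : Stk → List Cell := update (update (update (update (update (update (fun _ => []) (.x 0)
    (encodeLits c)) .fa [toCell .endClause]) .fa (encodeItems (items F (fun _ => .unset) fun _ =>
    ⟨false, false, false, false⟩))) (.x 1) (encodeLits F.flatten)) (.x 2) (encodeLits F.flatten))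
    (.x 3) (encodeLits F.flatten) with hS
  have h₃ : Runs (.load fun r => Reg.rest r.fl : Program) ⟨r, [], S⟩
      ⟨Reg.rest ⟨false, false, false, false, false⟩, [], S⟩ 1 := .load (by rw [hr]; rfl)
  obtain ⟨h₄, h₅⟩ := hp c F n hlc hlF S (⟨false, false, false, false, false⟩,
    items F (fun _ => .unset) fun _ => ⟨false, false, false, false⟩) (by
      refine ⟨fun k hk => ⟨?_, by simp [hS], by simp [hS]⟩, by simp [hS], by simp [hS],
        by simp [hS]⟩
      fin_cases k
      · simp at hk
      all_goals simp [hS]) (by simp [hS]) (by simp [hS]) (by simp [hS]) hli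
  set z := g c F (⟨false, false, false, false, false⟩,
    items F (fun _ => .unset) fun _ => ⟨false, false, false, false⟩) with hz
  have h₆ := runs_clearAll (Reg.rest z.1) (update S .fa (encodeItems z.2)) (by simp [hS])
    (by simp [hS]) (by simp [hS]) (by simp [hS]) (by simpa using h₅) (by
      intro i
      fin_cases i <;> simp [hS, hlc, hlF])
  obtain ⟨t, ht, h⟩ := Runs.seq h₁ (Runs.seq h₂ (Runs.seq h₃ (Runs.seq h₄ h₆)))
  refine ⟨t, _, ht.trans ?_, h, hf a⟩
  simp only [Polynomial.eval_add, Polynomial.eval_mul, Polynomial.eval_X, Polynomial.eval_ofNat]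
  omega

/-! ### The passes of the algorithm and its program -/

/-- A transducer that looks, in each clause, for two kinds of literals, that collects what it finds
in one flag, and that changes the marks. -/
structure Scan where
  seen : Mark → Option Bool → Bool
  other : Mark → Option Bool → Bool
  mark : Bool → Mark → Option Bool → Mark
  found : Bool → Bool → Tag → Bool
  tag : Bool → Bool → Tag → Tag

def Scan.toTransducer (σ : Scan) : Transducer where
  lit fl μ d := ({ fl with seen := fl.seen || σ.seen μ d, other := fl.other || σ.other μ d },
    σ.mark fl.found μ d)
  fin fl e := ({ fl with
    seen := false
    other := false
    found := fl.found || σ.found fl.seen fl.other e }, σ.tag fl.seen fl.other e)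

theorem Transducer.run_append (τ : Transducer) (m : Literal) (fl : Flags) (is js : List Item) :
    τ.run m fl (is ++ js) = ((τ.run m (τ.run m fl is).1 js).1,
      (τ.run m fl is).2 ++ (τ.run m (τ.run m fl is).1 js).2) := by
  induction is generalizing fl with
  | nil => rfl
  | cons i is ih => simp [run, ih]

theorem Scan.run_lits (σ : Scan) (m : Literal) (ρ : Literal → Mark) (k : List Literal)
    (fl : Flags) :
    σ.toTransducer.run m fl (k.map fun l => .lit l (ρ l)) =
      ({ fl with
        seen := fl.seen || k.any fun l => σ.seen (ρ l) (compareLiteral m l)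
        other := fl.other || k.any fun l => σ.other (ρ l) (compareLiteral m l) },
      k.map fun l => .lit l (σ.mark fl.found (ρ l) (compareLiteral m l))) := by
  induction k generalizing fl with
  | nil => simp [Transducer.run]
  | cons l k ih =>
    rw [List.map_cons, Transducer.run, ih]
    simp [Transducer.step, Scan.toTransducer, Bool.or_assoc]

/-- The alternative `h` ensures that all literals are marked according to the same value of `found`:
either the marks do not depend on it, or it does not change during the pass. -/
theorem Scan.run_items (σ : Scan) (m : Literal) (ρ : Literal → Mark) (e : List Literal → Tag)
    (F : List (List Literal)) (fl : Flags) (hs : fl.seen = false) (ho : fl.other = false)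
    (h : (∀ b, σ.mark b = σ.mark fl.found) ∨ ∀ s o e, σ.found s o e = false) :
    σ.toTransducer.run m fl (items F ρ e) =
      ({ fl with found := (fl.found || F.any fun k => σ.found
          (k.any fun l => σ.seen (ρ l) (compareLiteral m l))
          (k.any fun l => σ.other (ρ l) (compareLiteral m l)) (e k)) },
      items F (fun l => σ.mark fl.found (ρ l) (compareLiteral m l)) fun k => σ.tag
          (k.any fun l => σ.seen (ρ l) (compareLiteral m l))
          (k.any fun l => σ.other (ρ l) (compareLiteral m l)) (e k)) := by
  induction F generalizing fl with
  | nil => simp [Transducer.run, items]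
  | cons k F ih =>
    have h₁ : items (k :: F) ρ e = k.map (fun l => Item.lit l (ρ l)) ++ (.fin (e k) :: items F ρ e) := by
      simp [items]
    rw [h₁, Transducer.run_append, Scan.run_lits, Transducer.run]
    simp only [Transducer.step]
    rw [ih _ rfl rfl (h.imp (fun h b => (h b).trans (h _).symm) id)]
    have h₂ : ∀ b, (F.flatMap fun k => k.map (fun l => Item.lit l
        (σ.mark (fl.found || σ.found (k.any fun l => σ.seen (ρ l) (compareLiteral m l)) b (e k))
          (ρ l) (compareLiteral m l))))  = F.flatMap fun k => k.map fun l => Item.lit l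
        (σ.mark fl.found (ρ l) (compareLiteral m l)) := by
      rcases h with h | h
      · intro b
        simp only [fun b => h b]
      · simp [h]
    have h₃ : σ.mark (fl.found || σ.found (k.any fun l => σ.seen (ρ l) (compareLiteral m l))
        (k.any fun l => σ.other (ρ l) (compareLiteral m l)) (e k)) = σ.mark fl.found := by
      rcases h with h | h
      · exact h _
      · simp [h]
    simp [toTransducer, hs, ho, items, Bool.or_assoc, h₃]

theorem compareLiteral_eq (m l : Literal) : compareLiteral m l =
    if l = m then some true else if l = m.opp then some false else none := by
  rcases m with ⟨x, a⟩
  rcases l with ⟨y, b⟩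
  by_cases h : x = y
  · subst h
    cases a <;> cases b <;> simp [compareLiteral, Literal.opp]
  · have h' : ¬ y = x := fun h' => h h'.symm
    simp [compareLiteral, Literal.opp, h, h']

/-- Mark the literals of the clause to be checked and their opposites as dead. -/
def prepare : Scan where
  seen _ d := d == some true
  -- The list for `c` may repeat a literal. On its second occurrence the opposites are dead already
  -- and must not count as hits of another literal.
  other μ d := d == some false && μ != .dead
  mark _ μ d := if d.isSome then .dead else μ
  found _ _ _ := false
  tag s o e := ⟨e.missing || !s, e.hit || o, e.twice || (e.hit && o), e.active⟩

/-- Find out which clauses are to be used. -/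
def activate : Scan where
  seen μ _ := μ != .dead
  other _ _ := false
  mark _ μ _ := μ
  found _ _ _ := false
  tag s _ e := { e with active := !e.twice && (e.hit || s || e.missing) }

/-- Forget the assignment and make the current literal true or false. -/
def start (b : Bool) : Scan where
  seen _ _ := false
  other _ _ := false
  mark _ μ d := if μ = .dead then .dead else match d with
    | none => .unset
    | some b' => if b' = b then .yes else .no
  found _ _ _ := false
  tag _ _ e := e

/-- Find out whether a clause forces the current literal. -/
def check : Scan where
  seen μ d := d == some true && μ == .unset
  other μ d := μ == .yes || (μ == .unset && d != some true)
  mark _ μ _ := μ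
  found s o e := e.active && s && !o
  tag _ _ e := e

/-- Make the current literal true if it was found to be forced. -/
def assign : Scan where
  seen _ _ := false
  other _ _ := false
  mark f μ d := if f ∧ μ = .unset then match d with
    | none => .unset
    | some true => .yes
    | some false => .no
    else μ
  found _ _ _ := false
  tag _ _ e := e

/-- Find out whether all literals of a clause are false. -/
def conflict : Scan where
  seen μ _ := μ == .unset || μ == .yes
  other _ _ := false
  mark _ μ _ := μ
  found s _ e := e.active && !s
  tag _ _ e := e

/-- Unit propagation. -/
def propagate : Program :=
  forEach 2 (forEach 3 (.seq (pass 3 check.toTransducer) (.seq (pass 3 assign.toTransducer)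
    (.load fun r => Reg.rest { r.fl with found := false }))))

/-- Unit propagation from an assumption. -/
def tryLiteral (b : Bool) : Program :=
  .seq (pass 1 (start b).toTransducer) (.seq propagate (pass 1 conflict.toTransducer))

/-- Unit propagation from each literal and from its opposite. -/
def refute : Program :=
  -- A pass needs a current literal, hence activation takes place inside of the loop; repeating it
  -- does not change the outcome.
  forEach 1 (.seq (pass 1 activate.toTransducer) (.seq (tryLiteral true)
    (.seq (.load fun r => Reg.rest { r.fl with first := r.fl.found, found := false })
      (.seq (tryLiteral false) (.load fun r => Reg.rest { r.fl with
        ans := r.fl.ans || (r.fl.first && r.fl.found), first := false, found := false })))))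

/-- The program that checks superredundancy. -/
def checkSuperredundancy : Program :=
  .seq (forEach 0 (pass 0 prepare.toTransducer)) refute

/-! ### What the passes compute -/

/-- The literals of a set `P` and their opposites are dead. -/
def deadMark (P : List Literal) (l : Literal) : Mark := if l ∈ P ∨ l.opp ∈ P then .dead else .unset

/-- The marks of a partial assignment. -/
def markOf (c S : List Literal) (l : Literal) : Mark :=
  if l ∈ c ∨ l.opp ∈ c then .dead else if l ∈ S then .yes else if l.opp ∈ S then .no else .unset

/-- The marks of a clause. -/
def tagOf (P : List Literal) (k : List Literal) (act : Bool) : Tag :=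
  ⟨decide (∃ l ∈ P, l ∉ k), decide (∃ l ∈ P, l.opp ∈ k),
    decide (∃ l ∈ P, ∃ l' ∈ P, l ≠ l' ∧ l.opp ∈ k ∧ l'.opp ∈ k), act⟩

/-- Clauses that are used: they are not `c`, and at most one of their literals is the opposite of a
literal of `c`. -/
def isActive (c k : List Literal) : Bool :=
  !decide (∃ l ∈ c, ∃ l' ∈ c, l ≠ l' ∧ l.opp ∈ k ∧ l'.opp ∈ k) &&
    decide ((∃ l ∈ c, l.opp ∈ k) ∨ (∃ l ∈ k, l ∉ c ∧ l.opp ∉ c) ∨ ∃ l ∈ c, l ∉ k)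

/-- The flags between two subroutines. -/
def idle (ans : Bool) : Flags := ⟨false, false, false, false, ans⟩

/-- The hypothesis `hl` holds because `c` is no tautology. It guarantees that `l.opp` is dead
beforehand only if `l` itself was treated before, so that hits are counted once for each literal of
`c`. -/
theorem run_prepare (l : Literal) (P : List Literal) (hl : l.opp ∉ P) (F : List (List Literal))
    (ans : Bool) :
    prepare.toTransducer.run l (idle ans) (items F (deadMark P) fun k => tagOf P k false) =
      (idle ans, items F (deadMark (l :: P)) fun k => tagOf (l :: P) k false) := by
  rw [Scan.run_items _ _ _ _ _ _ rfl rfl (Or.inr fun _ _ _ => rfl)]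
  refine Prod.ext ?_ ?_
  · simp [prepare, idle]
  · have h₁ : (fun l' => prepare.mark (idle ans).found (deadMark P l') (compareLiteral l l')) =
        deadMark (l :: P) := by
      funext l'
      simp only [prepare, compareLiteral_eq, deadMark, List.mem_cons]
      have h : l' = l.opp ↔ l'.opp = l := Literal.eq_opp_comm
      by_cases h₁ : l' = l
      · simp [h₁]
      · by_cases h₂ : l'.opp = l
        · simp [h₁, h, h₂]
        · simp [h₁, h, h₂]
    have h₂ : ∀ k : List Literal, (k.any fun l' => prepare.seen (deadMark P l')
        (compareLiteral l l')) = decide (l ∈ k) := by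
      intro k
      rw [Bool.eq_iff_iff]
      simp only [prepare, compareLiteral_eq, List.any_eq_true, beq_iff_eq, decide_eq_true_eq]
      constructor
      · rintro ⟨l', hl', h⟩
        split_ifs at h with h₁ h₂
        · exact h₁ ▸ hl'
        · simp at h
      · exact fun h => ⟨l, h, by simp⟩
    have h₃ : ∀ k : List Literal, (k.any fun l' => prepare.other (deadMark P l')
        (compareLiteral l l')) = decide (l.opp ∈ k ∧ l ∉ P) := by
      intro k
      rw [Bool.eq_iff_iff]
      simp only [prepare, compareLiteral_eq, List.any_eq_true, Bool.and_eq_true, beq_iff_eq,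
        bne_iff_ne, decide_eq_true_eq]
      constructor
      · rintro ⟨l', hl', h, h'⟩
        split_ifs at h with h₁ h₂
        · simp at h
        · subst h₂
          refine ⟨hl', fun h => h' ?_⟩
          simp [deadMark, h]
      · rintro ⟨h, h'⟩
        exact ⟨l.opp, h, by simp [Literal.opp_ne], by simp [deadMark, hl, h']⟩
    simp only [h₁, h₂, h₃]
    congr 1
    funext k
    simp only [prepare, tagOf, Tag.mk.injEq, and_true]
    refine ⟨?_, ?_, ?_⟩
    · rw [Bool.eq_iff_iff]
      simp [or_comm]
    · rw [Bool.eq_iff_iff]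
      simp only [Bool.or_eq_true, decide_eq_true_eq, List.exists_mem_cons_iff]
      by_cases h : l ∈ P
      · simp only [h, not_true_eq_false, and_false, or_false]
        exact ⟨Or.inr, fun h' => h'.elim (fun h' => ⟨l, h, h'⟩) id⟩
      · simp [h, or_comm]
    · rw [Bool.eq_iff_iff]
      simp only [Bool.or_eq_true, Bool.and_eq_true, decide_eq_true_eq]
      constructor
      · rintro (⟨a, ha, b, hb, h⟩ | ⟨⟨a, ha, h⟩, h', hP⟩)
        · exact ⟨a, List.mem_cons_of_mem _ ha, b, List.mem_cons_of_mem _ hb, h⟩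
        · refine ⟨a, List.mem_cons_of_mem _ ha, l, List.mem_cons_self, ?_, h, h'⟩
          rintro rfl
          exact hP ha
      · have key : ∀ b ∈ P, l ≠ b → l.opp ∈ k → b.opp ∈ k →
            (∃ l ∈ P, ∃ l' ∈ P, l ≠ l' ∧ l.opp ∈ k ∧ l'.opp ∈ k) ∨
              (∃ l ∈ P, l.opp ∈ k) ∧ l.opp ∈ k ∧ l ∉ P := by
          intro b hb hne hlk hbk
          by_cases hP : l ∈ P
          · exact Or.inl ⟨l, hP, b, hb, hne, hlk, hbk⟩
          · exact Or.inr ⟨⟨b, hb, hbk⟩, hlk, hP⟩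
        rintro ⟨a, ha, b, hb, hne, hak, hbk⟩
        rcases List.mem_cons.1 ha with ha' | ha' <;> rcases List.mem_cons.1 hb with hb' | hb'
        · exact absurd (ha'.trans hb'.symm) hne
        · subst ha'
          exact key b hb' hne hak hbk
        · subst hb'
          exact key a ha' hne.symm hbk hak
        · exact Or.inl ⟨a, ha', b, hb', hne, hak, hbk⟩

theorem foldl_prepare (F : List (List Literal)) (ans : Bool) (c P : List Literal)
    (hc : ∀ l ∈ c ++ P, l.opp ∉ c ++ P) :
    c.foldl (fun (a : Flags × List Item) l => prepare.toTransducer.run l a.1 a.2)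
        (idle ans, items F (deadMark P) fun k => tagOf P k false) =
      (idle ans, items F (deadMark (c.reverse ++ P)) fun k => tagOf (c.reverse ++ P) k false) := by
  induction c generalizing P with
  | nil => rfl
  | cons l c ih =>
    rw [List.foldl_cons]
    have hl : l.opp ∉ P := fun h => hc l (by simp) (by simp [h])
    rw [run_prepare l P hl, ih]
    · simp
    · intro m hm hm'
      refine hc m ?_ ?_
      · simp only [List.mem_append, List.mem_cons] at hm ⊢
        tauto
      · simp only [List.mem_append, List.mem_cons] at hm' ⊢
        tauto

theorem deadMark_eq_markOf (c : List Literal) : deadMark c = markOf c [] := by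
  funext l
  simp [deadMark, markOf]

/-- The previous activity bits `act` are arbitrary: they are all `false` at first and those of
`isActive` in later rounds. -/
theorem run_activate (c S : List Literal) (m : Literal) (F : List (List Literal)) (ans : Bool)
    (act : List Literal → Bool) :
    activate.toTransducer.run m (idle ans) (items F (markOf c S) fun k => tagOf c k (act k)) =
      (idle ans, items F (markOf c S) fun k => tagOf c k (isActive c k)) := by
  rw [Scan.run_items _ _ _ _ _ _ rfl rfl (Or.inr fun _ _ _ => rfl)]
  refine Prod.ext ?_ ?_
  · simp [activate, idle]
  · have h : ∀ k : List Literal, (k.any fun l' => activate.seen (markOf c S l')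
        (compareLiteral m l')) = decide (∃ l ∈ k, l ∉ c ∧ l.opp ∉ c) := by
      intro k
      rw [Bool.eq_iff_iff]
      simp only [activate, List.any_eq_true, bne_iff_ne, decide_eq_true_eq, markOf, ← not_or]
      refine exists_congr fun l => and_congr_right fun _ => ?_
      by_cases h : l ∈ c ∨ l.opp ∈ c
      · simp [h]
      · simp only [h, if_false, not_false_eq_true, iff_true]
        split_ifs <;> simp
    simp only [h]
    simp only [activate]
    congr 1
    funext k
    simp only [tagOf, isActive, Tag.mk.injEq, true_and]
    rw [Bool.eq_iff_iff]
    simp [or_assoc]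

theorem markOf_eq_dead {c S : List Literal} {l : Literal} :
    markOf c S l = .dead ↔ l ∈ c ∨ l.opp ∈ c := by
  simp only [markOf]
  split_ifs <;> simp_all

theorem run_start (b : Bool) (c S : List Literal) (m : Literal) (F : List (List Literal))
    (fl : Flags) (hs : fl.seen = false) (ho : fl.other = false) (e : List Literal → Tag) :
    (start b).toTransducer.run m fl (items F (markOf c S) e) =
      (fl, items F (markOf c [if b then m else m.opp]) e) := by
  rw [Scan.run_items _ _ _ _ _ _ hs ho (Or.inr fun _ _ _ => rfl)]
  refine Prod.ext ?_ ?_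
  · refine Flags.ext rfl rfl ?_ rfl rfl
    simp [start]
  · have h₁ : (fun l' => (start b).mark fl.found (markOf c S l') (compareLiteral m l')) =
        markOf c [if b then m else m.opp] := by
      funext l
      simp only [start, markOf_eq_dead]
      by_cases hd : l ∈ c ∨ l.opp ∈ c
      · simp [hd, markOf]
      · simp only [hd, if_false, compareLiteral_eq, markOf, List.mem_singleton]
        have h : l.opp = m ↔ l = m.opp := Literal.eq_opp_comm.symm
        have h' : l.opp = m.opp ↔ l = m := by rw [← Literal.eq_opp_comm, Literal.opp_opp]
        have hm : m ≠ m.opp := (Literal.opp_ne m).symm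
        have hm' := Literal.opp_ne m
        by_cases h₁ : l = m
        · subst h₁
          cases b <;> simp [hm]
        · by_cases h₂ : l = m.opp
          · subst h₂
            cases b <;> simp [hm']
          · cases b <;> simp [h₁, h₂, h, h']
    simp only [h₁]
    simp [start]

/-- Does a clause force the literal `m`? -/
def isForced (c : List Literal) (F : List (List Literal)) (S : List Literal) (m : Literal) : Bool :=
  F.any fun k => isActive c k &&
    (k.any fun l => check.seen (markOf c S l) (compareLiteral m l)) &&
    !(k.any fun l => check.other (markOf c S l) (compareLiteral m l))

/-- Are all literals of a clause false? -/
def hasConflict (c : List Literal) (F : List (List Literal)) (S : List Literal) : Bool :=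
  F.any fun k => isActive c k && !(k.any fun l => markOf c S l == .unset || markOf c S l == .yes)

/-- Unit propagation of one literal. -/
def propagateStep (c : List Literal) (F : List (List Literal)) (S : List Literal) (m : Literal) :
    List Literal :=
  if isForced c F S m then m :: S else S

/-- One round of unit propagation. -/
def propagateRound (c : List Literal) (F : List (List Literal)) (S : List Literal) : List Literal :=
  F.flatten.foldl (propagateStep c F) S

/-- All rounds of unit propagation. -/
def propagateAll (c : List Literal) (F : List (List Literal)) (S : List Literal) : List Literal :=
  F.flatten.foldl (fun S _ => propagateRound c F S) S

theorem isForced_iff {c : List Literal} {F : List (List Literal)} {S : List Literal} {m : Literal} :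
    isForced c F S m = true ↔ ∃ k ∈ F, isActive c k = true ∧ m ∈ k ∧ markOf c S m = .unset ∧
      ∀ l ∈ k, markOf c S l ≠ .yes ∧ (markOf c S l = .unset → l = m) := by
  have hc : ∀ l, compareLiteral m l = some true ↔ l = m := by
    intro l
    rw [compareLiteral_eq]
    split_ifs with h₁ h₂ <;> simp [h₁]
  simp only [isForced, check, List.any_eq_true, Bool.and_eq_true, Bool.not_eq_true', beq_iff_eq,
    List.any_eq_false, Bool.or_eq_true, bne_iff_ne, hc, ne_eq, and_assoc]
  refine exists_congr fun k => and_congr_right fun _ => and_congr_right fun _ => ?_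
  constructor
  · rintro ⟨⟨l, hl, rfl, hu⟩, h⟩
    refine ⟨hl, hu, fun l' hl' => ⟨fun h' => h l' hl' (Or.inl h'), fun h' => ?_⟩⟩
    by_contra hne
    exact h l' hl' (Or.inr ⟨h', hne⟩)
  · rintro ⟨hl, hu, h⟩
    refine ⟨⟨m, hl, rfl, hu⟩, fun l' hl' h' => ?_⟩
    rcases h' with h' | ⟨h', hne⟩
    · exact (h l' hl').1 h'
    · exact hne ((h l' hl').2 h')

theorem hasConflict_iff {c : List Literal} {F : List (List Literal)} {S : List Literal} :
    hasConflict c F S = true ↔ ∃ k ∈ F, isActive c k = true ∧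
      ∀ l ∈ k, markOf c S l ≠ .unset ∧ markOf c S l ≠ .yes := by
  simp [hasConflict]

theorem run_check (c S : List Literal) (m : Literal) (F : List (List Literal))
    (fl : Flags) (hs : fl.seen = false) (ho : fl.other = false) (hf : fl.found = false) :
    check.toTransducer.run m fl (items F (markOf c S) fun k => tagOf c k (isActive c k)) =
      ({ fl with found := isForced c F S m },
        items F (markOf c S) fun k => tagOf c k (isActive c k)) := by
  rw [Scan.run_items _ _ _ _ _ _ hs ho (Or.inl fun _ => rfl), hf]
  rfl

theorem run_conflict (c S : List Literal) (m : Literal) (F : List (List Literal))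
    (fl : Flags) (hs : fl.seen = false) (ho : fl.other = false) (hf : fl.found = false) :
    conflict.toTransducer.run m fl (items F (markOf c S) fun k => tagOf c k (isActive c k)) =
      ({ fl with found := hasConflict c F S },
        items F (markOf c S) fun k => tagOf c k (isActive c k)) := by
  rw [Scan.run_items _ _ _ _ _ _ hs ho (Or.inl fun _ => rfl), hf]
  rfl

theorem run_assign (c S : List Literal) (m : Literal) (F : List (List Literal))
    (fl : Flags) (hs : fl.seen = false) (ho : fl.other = false)
    (hf : fl.found = isForced c F S m) (e : List Literal → Tag) :
    assign.toTransducer.run m fl (items F (markOf c S) e) =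
      (fl, items F (markOf c (propagateStep c F S m)) e) := by
  rw [Scan.run_items _ _ _ _ _ _ hs ho (Or.inr fun _ _ _ => rfl)]
  refine Prod.ext ?_ ?_
  · refine Flags.ext rfl rfl ?_ rfl rfl
    simp [assign]
  · have h₁ : (fun l' => assign.mark fl.found (markOf c S l') (compareLiteral m l')) =
        markOf c (propagateStep c F S m) := by
      funext l
      simp only [assign, hf, propagateStep]
      by_cases hF : isForced c F S m = true
      · obtain ⟨-, -, -, -, hu, -⟩ := isForced_iff.1 hF
        have h : l = m.opp ↔ l.opp = m := Literal.eq_opp_comm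
        simp only [hF, if_true, true_and, compareLiteral_eq]
        by_cases h₁ : l = m
        · subst h₁
          have h₃ : ¬ (l ∈ c ∨ l.opp ∈ c) := by
            rw [← markOf_eq_dead (S := S), hu]
            simp
          rw [hu]
          simp [markOf, h₃]
        · by_cases h₂ : l.opp = m
          · have h₃ : markOf c S l = .unset := by
              rw [← h₂] at hu
              simp only [markOf, Literal.opp_opp] at hu ⊢
              split_ifs at hu with h₄ h₅ h₆
              rw [or_comm] at h₄
              simp [h₄, h₅, h₆]
            have h₄ : ¬ (l ∈ c ∨ l.opp ∈ c) := by
              rw [← markOf_eq_dead (S := S), h₃]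
              simp
            have h₅ : l ∉ S := by
              intro h₅
              simp [markOf, h₄, h₅] at h₃
            rw [h₃]
            rw [h₂] at h₄
            simp [h₁, h, h₂, markOf, h₄, h₅]
          · simp [h₁, h, h₂, markOf]
            split_ifs <;> simp_all
      · simp [hF]
    simp only [h₁]
    simp [assign]

/-! ### The program implements the algorithm, with time bounds -/

/-- What one step of unit propagation does. -/
def checkAssign (m : Literal) (a : Flags × List Item) : Flags × List Item :=
  let b := check.toTransducer.run m a.1 a.2
  let b' := assign.toTransducer.run m b.1 b.2
  ({ b'.1 with found := false }, b'.2)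

/-- What unit propagation does. -/
def propagateItems (V : List Literal) (a : Flags × List Item) : Flags × List Item :=
  V.foldl (fun a _ => V.foldl (fun a m => checkAssign m a) a) a

/-- What unit propagation from an assumption does. -/
def tryItems (V : List Literal) (b : Bool) (m : Literal) (a : Flags × List Item) :
    Flags × List Item :=
  let a₁ := (start b).toTransducer.run m a.1 a.2
  let a₂ := propagateItems V a₁
  conflict.toTransducer.run m a₂.1 a₂.2

/-- What unit propagation from a literal and from its opposite does. -/
def refuteStep (V : List Literal) (a : Flags × List Item) (m : Literal) : Flags × List Item :=
  let a₀ := activate.toTransducer.run m a.1 a.2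
  let a₁ := tryItems V true m a₀
  let a₂ := tryItems V false m ({ a₁.1 with first := a₁.1.found, found := false }, a₁.2)
  ({ a₂.1 with ans := a₂.1.ans || (a₂.1.first && a₂.1.found), first := false, found := false },
    a₂.2)

/-- What the whole program does. -/
def checkItems (c V : List Literal) (a : Flags × List Item) : Flags × List Item :=
  V.foldl (refuteStep V) (c.foldl (fun a l => prepare.toTransducer.run l a.1 a.2) a)

open Polynomial

/-- The time of a pass. -/
noncomputable def passTime : ℕ[X] := X * (9 * X + 14) + 4

/-- The time of a loop. -/
noncomputable def loopTime (q : ℕ[X]) : ℕ[X] := X * (q + 9 * X + 9) + 3 * X + 4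

theorem implements_pass_inside {V : List Literal} (i : Fin 4) (τ : Transducer) (m : Literal) {n : ℕ}
    (hn : (encodeMarked m .unset).length ≤ n) :
    Implements (pass i τ) (Inside V i m) (fun a => τ.run m a.1 a.2) n (passTime.eval n) :=
  (implements_pass i τ m hn).mono (fun _ h => h.2) (fun _ => rfl) (by simp [passTime])

theorem implements_forEach_loopTime {V : List Literal} {i : Fin 4} {ls : List Literal}
    {body : Program} {g : Flags × List Item → Literal → Flags × List Item} {n : ℕ} {q : ℕ[X]}
    (hls : (encodeLits ls).length ≤ n)
    (hbody : ∀ l ∈ ls, Implements body (Inside V i l) (fun a => g a l) n (q.eval n)) :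
    Implements (forEach i body) (Before V i ls) (fun a => ls.foldl g a) n ((loopTime q).eval n) :=
  (implements_forEach hls hbody).mono (fun _ h => h) (fun _ => rfl) (by simp [loopTime])

theorem Ready.before {V : List Literal} {i j : Fin 4} (hij : i < j) {S : Stk → List Cell}
    (h : Ready V i S) : Before V j V S :=
  ⟨fun k hk => h k (hij.trans hk), h j hij⟩

theorem implements_propagate {V : List Literal} {n : ℕ} (hV : (encodeLits V).length ≤ n)
    (l : Literal) :
    Implements propagate (Inside V 1 l) (propagateItems V) n
      ((loopTime (loopTime (passTime + (passTime + 1)))).eval n) := by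
  refine (implements_forEach_loopTime (V := V) (i := 2) (ls := V)
    (q := loopTime (passTime + (passTime + 1))) hV (fun m _ =>
    (implements_forEach_loopTime (V := V) (i := 3) (ls := V)
      (g := fun a m => checkAssign m a) (q := passTime + (passTime + 1)) hV
      fun m hm => ?_).mono (fun S h => h.1.before (by decide)) (fun _ => rfl) le_rfl)).mono
    (fun S h => h.1.before (by decide)) (fun _ => rfl) le_rfl
  have hm := (length_encodeMarked_le_encodeLits hm).trans hV
  refine (Implements.seq (fun S w h => h.update_fa w) (implements_pass_inside 3 _ m hm)
    (Implements.seq (fun S w h => h.update_fa w) (implements_pass_inside 3 _ m hm)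
    (implements_load (fun fl => { fl with found := false }) _ n))).mono (fun _ h => h) (fun _ => rfl) ?_
  simp

theorem implements_tryLiteral {V : List Literal} {n : ℕ} (hV : (encodeLits V).length ≤ n) (b : Bool)
    (l : Literal) (hl : (encodeMarked l .unset).length ≤ n) :
    Implements (tryLiteral b) (Inside V 1 l) (tryItems V b l) n
      ((passTime + (loopTime (loopTime (passTime + (passTime + 1))) + passTime)).eval n) := by
  refine (Implements.seq (fun S w h => h.update_fa w) (implements_pass_inside 1 _ l hl)
    (Implements.seq (fun S w h => h.update_fa w) (implements_propagate hV l)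
    (implements_pass_inside 1 _ l hl))).mono (fun _ h => h) (fun _ => rfl) (by simp)

/-- The time of unit propagation from an assumption. -/
noncomputable def tryTime : ℕ[X] :=
  passTime + (loopTime (loopTime (passTime + (passTime + 1))) + passTime)

theorem implements_refute {V : List Literal} {n : ℕ} (hV : (encodeLits V).length ≤ n) :
    Implements refute (Before V 1 V) (fun a => V.foldl (refuteStep V) a) n
      ((loopTime (passTime + (tryTime + (1 + (tryTime + 1))))).eval n) := by
  refine implements_forEach_loopTime (q := passTime + (tryTime + (1 + (tryTime + 1)))) hV
    fun l hl => ?_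
  have hl := (length_encodeMarked_le_encodeLits hl).trans hV
  refine (Implements.seq (fun S w h => h.update_fa w) (implements_pass_inside 1 _ l hl)
    (Implements.seq (fun S w h => h.update_fa w) (implements_tryLiteral hV true l hl)
    (Implements.seq (fun S w h => h.update_fa w) (implements_load (fun fl => { fl with first := fl.found, found := false }) _ n)
    (Implements.seq (fun S w h => h.update_fa w) (implements_tryLiteral hV false l hl)
    (implements_load (fun fl => { fl with
      ans := fl.ans || (fl.first && fl.found), first := false, found := false }) _ n))))).mono (fun _ h => h) (fun _ => rfl) ?_
  simp [tryTime]

/-- The time of the whole program. -/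
noncomputable def checkTime : ℕ[X] :=
  loopTime passTime + loopTime (passTime + (tryTime + (1 + (tryTime + 1))))

theorem implements_checkSuperredundancy {c V : List Literal} {n : ℕ}
    (hc : (encodeLits c).length ≤ n) (hV : (encodeLits V).length ≤ n) :
    Implements checkSuperredundancy (Before V 0 c) (checkItems c V) n (checkTime.eval n) := by
  refine (Implements.seq (fun S w h => h.update_fa w) (implements_forEach_loopTime
    (g := fun a l => prepare.toTransducer.run l a.1 a.2) hc fun l hl => implements_pass_inside 0 _ l
      ((length_encodeMarked_le_encodeLits hl).trans hc))
    ((implements_refute hV).mono (fun S h => h.1.before (by decide)) (fun _ => rfl) le_rfl)).mono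
    (fun _ h => h) (fun _ => rfl) (by simp [checkTime])

/-- The items of a formula in the course of unit propagation. -/
def activeItems (c : List Literal) (F : List (List Literal)) (S : List Literal) : List Item :=
  items F (markOf c S) fun k => tagOf c k (isActive c k)

theorem checkAssign_eq (c : List Literal) (F : List (List Literal)) (S : List Literal)
    (m : Literal) (fl : Flags) (hs : fl.seen = false) (ho : fl.other = false)
    (hf : fl.found = false) :
    checkAssign m (fl, activeItems c F S) = (fl, activeItems c F (propagateStep c F S m)) := by
  simp only [checkAssign, activeItems]
  rw [run_check c S m F fl hs ho hf]
  rw [run_assign c S m F { fl with found := isForced c F S m } hs ho rfl]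
  refine Prod.ext ?_ rfl
  exact Flags.ext rfl rfl hf.symm rfl rfl

theorem propagateItems_eq (c : List Literal) (F : List (List Literal)) (S : List Literal)
    (fl : Flags) (hs : fl.seen = false) (ho : fl.other = false) (hf : fl.found = false) :
    propagateItems F.flatten (fl, activeItems c F S) =
      (fl, activeItems c F (propagateAll c F S)) := by
  have h₁ : ∀ (V S : List Literal), V.foldl (fun a m => checkAssign m a) (fl, activeItems c F S) =
      (fl, activeItems c F (V.foldl (propagateStep c F) S)) := by
    intro V
    induction V with
    | nil => exact fun S => rfl
    | cons m V ih =>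
      intro S
      rw [List.foldl_cons, checkAssign_eq c F S m fl hs ho hf, ih, List.foldl_cons]
  have h₂ : ∀ (W S : List Literal), W.foldl (fun a _ => F.flatten.foldl
      (fun a m => checkAssign m a) a) (fl, activeItems c F S) =
      (fl, activeItems c F (W.foldl (fun S _ => propagateRound c F S) S)) := by
    intro W
    induction W with
    | nil => exact fun S => rfl
    | cons m W ih =>
      intro S
      rw [List.foldl_cons, h₁, ih, List.foldl_cons]
      rfl
  exact h₂ F.flatten S

theorem tryItems_eq (c : List Literal) (F : List (List Literal)) (S : List Literal) (b : Bool)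
    (m : Literal) (fl : Flags) (hs : fl.seen = false) (ho : fl.other = false)
    (hf : fl.found = false) :
    tryItems F.flatten b m (fl, activeItems c F S) =
      ({ fl with found := hasConflict c F (propagateAll c F [if b then m else m.opp]) },
        activeItems c F (propagateAll c F [if b then m else m.opp])) := by
  simp only [tryItems]
  have h₁ : (start b).toTransducer.run m fl (activeItems c F S) = (fl, activeItems c F _) :=
    run_start b c S m F fl hs ho _
  rw [h₁, propagateItems_eq c F _ fl hs ho hf]
  exact run_conflict c _ m F fl hs ho hf

/-- Is there a contradiction both from the literal `m` and from its opposite? -/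
def isRefuted (c : List Literal) (F : List (List Literal)) (m : Literal) : Bool :=
  hasConflict c F (propagateAll c F [m]) && hasConflict c F (propagateAll c F [m.opp])

theorem refuteStep_eq (c : List Literal) (F : List (List Literal)) (S : List Literal)
    (act : List Literal → Bool) (m : Literal) (ans : Bool) :
    refuteStep F.flatten (idle ans, items F (markOf c S) fun k => tagOf c k (act k)) m =
      (idle (ans || isRefuted c F m), activeItems c F (propagateAll c F [m.opp])) := by
  have h₀ : activate.toTransducer.run m (idle ans) (items F (markOf c S) fun k =>
      tagOf c k (act k)) = (idle ans, activeItems c F S) := run_activate c S m F ans act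
  simp only [refuteStep]
  rw [h₀]
  have h₁ := tryItems_eq c F S true m (idle ans) rfl rfl rfl
  simp only [if_true] at h₁
  rw [h₁]
  have h₂ := tryItems_eq c F (propagateAll c F [m]) false m
    { idle ans with first := hasConflict c F (propagateAll c F [m]), found := false } rfl rfl rfl
  simp only [Bool.false_eq_true, if_false] at h₂
  rw [h₂]
  rfl

/-- The round of a literal leaves the marks of its last propagation behind; they are harmless since
`start` forgets them, hence the generalization over `S`. -/
theorem foldl_refuteStep (c : List Literal) (F : List (List Literal)) (V S : List Literal)
    (act : List Literal → Bool) (ans : Bool) :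
    (V.foldl (refuteStep F.flatten)
      (idle ans, items F (markOf c S) fun k => tagOf c k (act k))).1 =
      idle (ans || V.any (isRefuted c F)) := by
  induction V generalizing S act ans with
  | nil => simp
  | cons m V ih =>
    rw [List.foldl_cons, refuteStep_eq, activeItems, ih]
    simp [Bool.or_assoc]

theorem checkItems_ans (c : List Literal) (hc : ∀ l ∈ c, l.opp ∉ c) (F : List (List Literal)) :
    (checkItems c F.flatten (⟨false, false, false, false, false⟩, items F (fun _ => .unset)
      fun _ => ⟨false, false, false, false⟩)).1.ans =
      F.flatten.any (isRefuted c.reverse F) := by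
  have h := foldl_prepare F false c [] (by simpa using hc)
  have h₁ : deadMark [] = fun _ => Mark.unset := by
    funext l
    simp [deadMark]
  have h₂ : (fun k => tagOf [] k false) = fun _ => ⟨false, false, false, false⟩ := by
    funext k
    simp [tagOf]
  rw [h₁, h₂] at h
  simp only [checkItems]
  rw [show (⟨false, false, false, false, false⟩ : Flags) = idle false from rfl, h,
    deadMark_eq_markOf, List.append_nil, foldl_refuteStep]
  simp [idle]

/-! ### Superredundancy as unsatisfiability of the active parts -/

/-- `v` satisfies the parts of the used clauses that have no variable in common with `c`. -/
def SatisfiesActive (c : List Literal) (F : List (List Literal)) (v : Variable → Bool) : Prop :=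
  ∀ k ∈ F, isActive c k = true → ∃ l ∈ k, l ∉ c ∧ l.opp ∉ c ∧ v l.1 = l.2

theorem isActive_iff {c k : List Literal} : isActive c k = true ↔
    (¬ ∃ l ∈ c, ∃ l' ∈ c, l ≠ l' ∧ l.opp ∈ k ∧ l'.opp ∈ k) ∧
      ((∃ l ∈ c, l.opp ∈ k) ∨ (∃ l ∈ k, l ∉ c ∧ l.opp ∉ c) ∨ ∃ l ∈ c, l ∉ k) := by
  rw [isActive, Bool.and_eq_true, Bool.not_eq_true', decide_eq_false_iff_not, decide_eq_true_eq]

/-- Variables of `c` do not occur in the active parts, so an assignment that satisfies these can be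
changed to falsify `c`. A clause that is not active either contains two opposites of literals of
`c`, hence is robust, or equals `c`. -/
theorem superredundant_iff_active {F : List (List Literal)} {c : List Literal}
    (hF : TautologyFree (clausesOf F)) (hc : c.toFinset ∈ clausesOf F) :
    Superredundant (clausesOf F) c.toFinset ↔ ¬ ∃ v, SatisfiesActive c F v := by
  rw [superredundant_iff_robustlySatisfied hF hc, not_iff_not]
  have hct : ∀ l ∈ c, l.opp ∉ c := fun l hl hl' =>
    hF _ hc ⟨l, by simpa using hl, by simpa using hl'⟩
  constructor
  · rintro ⟨v, hv, h⟩
    have hfalse : ∀ l ∈ c, v l.1 ≠ l.2 := fun l hl hvl => hv ⟨l, by simpa using hl, hvl⟩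
    refine ⟨v, fun k hk hact => ?_⟩
    obtain ⟨h₁, h₂⟩ := isActive_iff.1 hact
    have hkc : k.toFinset ≠ c.toFinset := by
      intro heq
      have hmem : ∀ l, l ∈ k ↔ l ∈ c := fun l => by
        have := Finset.ext_iff.1 heq l
        simpa using this
      rcases h₂ with ⟨l, hl, hlk⟩ | ⟨l, hl, hlc, -⟩ | ⟨l, hl, hlk⟩
      · exact hct l hl ((hmem _).1 hlk)
      · exact hlc ((hmem _).1 hl)
      · exact hlk ((hmem _).2 hl)
    obtain ⟨⟨m₀, hm₀, hmv₀⟩, hrob⟩ := h _ ⟨k, hk, rfl⟩ hkc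
    by_cases hhit : ∃ l ∈ c, l.opp ∈ k
    · obtain ⟨l, hl, hlk⟩ := hhit
      obtain ⟨m, hm, hmv⟩ := hrob l (by simpa using hl)
      simp only [Finset.mem_erase, List.mem_toFinset] at hm
      refine ⟨m, hm.2, fun hmc => hfalse m hmc hmv, fun hmc => h₁ ⟨l, hl, m.opp, hmc, ?_, hlk, ?_⟩,
        hmv⟩
      · rintro rfl
        simp at hm
      · simpa using hm.2
    · simp only [List.mem_toFinset] at hm₀
      exact ⟨m₀, hm₀, fun hmc => hfalse m₀ hmc hmv₀,
        fun hmc => hhit ⟨m₀.opp, hmc, by simpa using hm₀⟩, hmv₀⟩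
  · rintro ⟨v, hv⟩
    -- `v` overwritten so as to falsify `c`, which is possible because `c` is no tautology.
    let w : Variable → Bool := fun y =>
      if (y, true) ∈ c then false else if (y, false) ∈ c then true else v y
    have hwc : ∀ l ∈ c, w l.1 ≠ l.2 := by
      rintro ⟨y, b⟩ hl
      have := hct _ hl
      cases b
      · simp only [Literal.opp, Bool.not_false] at this
        simp [w, hl, this]
      · simp [w, hl]
    have hwo : ∀ l ∈ c, w l.opp.1 = l.opp.2 := fun l hl => Literal.val_opp.2 (hwc l hl)
    have hwn : ∀ l : Literal, l ∉ c → l.opp ∉ c → w l.1 = v l.1 := by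
      rintro ⟨y, b⟩ h₁ h₂
      cases b
      · simp only [Literal.opp, Bool.not_false] at h₂
        simp [w, h₁, h₂]
      · simp only [Literal.opp, Bool.not_true] at h₂
        simp [w, h₁, h₂]
    refine ⟨w, ?_, ?_⟩
    · rintro ⟨l, hl, hwl⟩
      exact hwc l (by simpa using hl) hwl
    · rintro d ⟨k, hk, rfl⟩ hkc
      by_cases hact : isActive c k = true
      · obtain ⟨l, hl, h₁, h₂, hvl⟩ := hv k hk hact
        have hwl : w l.1 = l.2 := (hwn l h₁ h₂).trans hvl
        refine ⟨⟨l, by simpa using hl, hwl⟩, fun m hm => ⟨l, ?_, hwl⟩⟩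
        simp only [List.mem_toFinset] at hm
        simp only [Finset.mem_erase, List.mem_toFinset]
        refine ⟨?_, hl⟩
        rintro rfl
        exact h₂ (by simpa using hm)
      · rw [isActive_iff, not_and_or, not_not] at hact
        rcases hact with ⟨l, hl, l', hl', hne, hlk, hlk'⟩ | hact
        · refine ⟨⟨l.opp, by simpa using hlk, hwo l hl⟩, fun m hm => ?_⟩
          by_cases hml : m = l
          · subst hml
            refine ⟨l'.opp, ?_, hwo l' hl'⟩
            simp only [Finset.mem_erase, List.mem_toFinset]
            refine ⟨fun h => hne ?_, hlk'⟩
            rw [← Literal.opp_opp m, ← h, Literal.opp_opp]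
          · refine ⟨l.opp, ?_, hwo l hl⟩
            simp only [Finset.mem_erase, List.mem_toFinset]
            refine ⟨fun h => hml ?_, hlk⟩
            rw [← Literal.opp_opp m, ← h, Literal.opp_opp]
        · push Not at hact
          obtain ⟨h₁, h₂, h₃⟩ := hact
          refine absurd (Finset.ext fun l => ?_) hkc
          simp only [List.mem_toFinset]
          refine ⟨fun hl => ?_, h₃ l⟩
          by_contra hlc
          exact h₁ l.opp (h₂ l hl hlc) (by simpa using hl)

/-! ### Soundness of unit propagation -/

theorem markOf_eq_yes {c S : List Literal} {l : Literal} :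
    markOf c S l = .yes ↔ (l ∉ c ∧ l.opp ∉ c) ∧ l ∈ S := by
  rw [← not_or]
  simp only [markOf]
  split_ifs <;> simp_all

theorem markOf_eq_unset {c S : List Literal} {l : Literal} :
    markOf c S l = .unset ↔ (l ∉ c ∧ l.opp ∉ c) ∧ l ∉ S ∧ l.opp ∉ S := by
  rw [← not_or]
  simp only [markOf]
  split_ifs <;> simp_all

/-- The assignment `v` makes the literals in `S` true, apart from the dead ones. -/
def Agrees (c : List Literal) (v : Variable → Bool) (S : List Literal) : Prop :=
  ∀ l ∈ S, l ∉ c → l.opp ∉ c → v l.1 = l.2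

theorem Agrees.not_opp_mem {c S : List Literal} {v : Variable → Bool} (h : Agrees c v S)
    {l : Literal} (h₁ : l ∉ c) (h₂ : l.opp ∉ c) (hl : v l.1 = l.2) : l.opp ∉ S := fun hS =>
  Literal.val_opp.1 (h l.opp hS h₂ (by simpa using h₁)) hl

/-- In a clause that forces `m`, every live literal other than `m` is false under `S`, hence under
`v`; so it is `m` that makes the clause true. -/
theorem Agrees.propagateStep {c : List Literal} {F : List (List Literal)} {v : Variable → Bool}
    (hv : SatisfiesActive c F v) {S : List Literal} (h : Agrees c v S) (m : Literal) :
    Agrees c v (propagateStep c F S m) := by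
  unfold StackProgram.propagateStep
  split_ifs with hf
  · obtain ⟨k, hk, hact, -, -, hk'⟩ := isForced_iff.1 hf
    obtain ⟨l, hl, h₁, h₂, hvl⟩ := hv k hk hact
    have hlm : l = m := by
      refine (hk' l hl).2 (markOf_eq_unset.2 ⟨⟨h₁, h₂⟩, fun hS => ?_, h.not_opp_mem h₁ h₂ hvl⟩)
      exact (hk' l hl).1 (markOf_eq_yes.2 ⟨⟨h₁, h₂⟩, hS⟩)
    subst hlm
    intro l' hl'
    rcases List.mem_cons.1 hl' with rfl | hl'
    · exact fun _ _ => hvl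
    · exact h l' hl'
  · exact h

theorem propagateAll_induction {c : List Literal} {F : List (List Literal)} {S : List Literal}
    {p : List Literal → Prop} (h : p S) (hstep : ∀ S m, p S → p (propagateStep c F S m)) :
    p (propagateAll c F S) := by
  have h₁ : ∀ (V S : List Literal), p S → p (V.foldl (propagateStep c F) S) := by
    intro V
    induction V with
    | nil => exact fun S h => h
    | cons m V ih => exact fun S h => ih _ (hstep S m h)
  have h₂ : ∀ (W S : List Literal), p S → p (W.foldl (fun S _ => propagateRound c F S) S) := by
    intro W
    induction W with
    | nil => exact fun S h => h
    | cons m W ih => exact fun S h => ih _ (h₁ _ S h)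
  exact h₂ _ S h

theorem Agrees.hasConflict {c : List Literal} {F : List (List Literal)} {v : Variable → Bool}
    (hv : SatisfiesActive c F v) {S : List Literal} (h : Agrees c v S) :
    hasConflict c F S = false := by
  rw [← Bool.not_eq_true, hasConflict_iff]
  rintro ⟨k, hk, hact, hk'⟩
  obtain ⟨l, hl, h₁, h₂, hvl⟩ := hv k hk hact
  refine (hk' l hl).1 (markOf_eq_unset.2 ⟨⟨h₁, h₂⟩, fun hS => ?_, h.not_opp_mem h₁ h₂ hvl⟩)
  exact (hk' l hl).2 (markOf_eq_yes.2 ⟨⟨h₁, h₂⟩, hS⟩)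

/-- A literal is not refuted if the used clauses are satisfiable. -/
theorem isRefuted_eq_false {c : List Literal} {F : List (List Literal)} {v : Variable → Bool}
    (hv : SatisfiesActive c F v) (m : Literal) : isRefuted c F m = false := by
  have key : ∀ l : Literal, v l.1 = l.2 → StackProgram.hasConflict c F (propagateAll c F [l]) = false := by
    intro l hl
    refine Agrees.hasConflict hv (propagateAll_induction ?_ fun S m h => h.propagateStep hv m)
    intro l' hl' _ _
    rw [List.mem_singleton.1 hl', hl]
  by_cases hm : v m.1 = m.2
  · simp [isRefuted, key m hm]
  · simp [isRefuted, key m.opp (Literal.val_opp.2 hm)]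

/-! ### Saturation of unit propagation -/

/-- Unit propagation has no effect on `S`. -/
def Saturated (c : List Literal) (F : List (List Literal)) (S : List Literal) : Prop :=
  ∀ m ∈ F.flatten, isForced c F S m = false

/-- Literals are only added. As long as none is, all tests are made against the same `S`. -/
theorem foldl_propagateStep (c : List Literal) (F : List (List Literal)) (V S : List Literal) :
    ((∀ m ∈ V, isForced c F S m = false) ∧ V.foldl (propagateStep c F) S = S) ∨
      S.length < (V.foldl (propagateStep c F) S).length := by
  have hle : ∀ (V S : List Literal), S.length ≤ (V.foldl (propagateStep c F) S).length := by
    intro V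
    induction V with
    | nil => exact fun S => le_rfl
    | cons m V ih =>
      intro S
      refine le_trans ?_ (ih _)
      unfold propagateStep
      split_ifs <;> simp
  induction V generalizing S with
  | nil => exact Or.inl ⟨by simp, rfl⟩
  | cons m V ih =>
    by_cases h : isForced c F S m = true
    · right
      refine lt_of_lt_of_le ?_ (hle V _)
      simp [propagateStep, h]
    · have h' : propagateStep c F S m = S := by simp [propagateStep, h]
      rw [List.foldl_cons, h']
      refine (ih S).imp_left fun h₁ => ⟨?_, h₁.2⟩
      intro m' hm'
      rcases List.mem_cons.1 hm' with rfl | hm'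
      · simpa using h
      · exact h₁.1 m' hm'

theorem foldl_propagateRound (c : List Literal) (F : List (List Literal)) (W S : List Literal) :
    Saturated c F (W.foldl (fun S _ => propagateRound c F S) S) ∨
      S.length + W.length ≤ (W.foldl (fun S _ => propagateRound c F S) S).length := by
  induction W generalizing S with
  | nil => exact Or.inr le_rfl
  | cons m W ih =>
    rw [List.foldl_cons]
    rcases foldl_propagateStep c F F.flatten S with ⟨h₁, h₂⟩ | h
    · left
      have h₂ : propagateRound c F S = S := h₂
      have h₃ : ∀ W : List Literal, W.foldl (fun S _ => propagateRound c F S) S = S := by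
        intro W
        induction W with
        | nil => rfl
        | cons m W ih => rw [List.foldl_cons, h₂, ih]
      rw [h₂, h₃]
      exact h₁
    · refine (ih (propagateRound c F S)).imp_right fun h' => ?_
      have h : S.length < (propagateRound c F S).length := h
      simp only [List.length_cons]
      omega

/-- No literal is both true and false. -/
def Consistent (S : List Literal) : Prop := ∀ l ∈ S, l.opp ∉ S

theorem consistent_propagateAll (c : List Literal) (F : List (List Literal)) (x : Literal) :
    Consistent (propagateAll c F [x]) := by
  refine propagateAll_induction ?_ fun S m h => ?_
  · intro l hl hl'
    rw [List.mem_singleton] at hl hl'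
    subst hl
    exact Literal.opp_ne _ hl'
  · unfold propagateStep
    split_ifs with hf
    · obtain ⟨-, -, -, -, hu, -⟩ := isForced_iff.1 hf
      obtain ⟨-, h₁, h₂⟩ := markOf_eq_unset.1 hu
      intro l hl hl'
      rcases List.mem_cons.1 hl with rfl | hl <;> rcases List.mem_cons.1 hl' with hl' | hl'
      · exact Literal.opp_ne _ hl'
      · exact h₂ hl'
      · rw [← hl'] at h₂
        exact h₂ (by simpa using hl)
      · exact h l hl hl'
    · exact h

/-- Every round that is not yet saturated adds a literal, and there are as many rounds as literal
occurrences. If all of them add one, the list, which has no repetitions and lies in `x ::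
F.flatten`, exhausts it by counting; then no literal of `F` is unset and none can be forced. -/
theorem saturated_propagateAll (c : List Literal) (F : List (List Literal)) (x : Literal) :
    Saturated c F (propagateAll c F [x]) := by
  rcases foldl_propagateRound c F F.flatten [x] with h | h
  · exact h
  · have h : [x].length + F.flatten.length ≤ (propagateAll c F [x]).length := h
    have h₁ : (propagateAll c F [x]).Nodup ∧ propagateAll c F [x] ⊆ x :: F.flatten := by
      refine propagateAll_induction (p := fun S => S.Nodup ∧ S ⊆ x :: F.flatten) (by simp)
        fun S m h => ?_
      unfold propagateStep
      split_ifs with hf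
      · obtain ⟨k, hk, -, hmk, hu, -⟩ := isForced_iff.1 hf
        obtain ⟨-, h₁, -⟩ := markOf_eq_unset.1 hu
        exact ⟨List.nodup_cons.2 ⟨h₁, h.1⟩, List.cons_subset.2
          ⟨List.mem_cons_of_mem _ (List.mem_flatten.2 ⟨k, hk, hmk⟩), h.2⟩⟩
      · exact h
    have h₂ := (List.subperm_of_subset h₁.1 h₁.2).perm_of_length_le (by
      simp only [List.length_cons, List.length_nil] at h ⊢
      omega)
    intro m hm
    rw [← Bool.not_eq_true]
    intro hf
    obtain ⟨-, -, -, -, hu, -⟩ := isForced_iff.1 hf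
    exact (markOf_eq_unset.1 hu).2.1 (h₂.mem_iff.2 (List.mem_cons_of_mem _ hm))

/-- A saturated set without conflict has, in each used clause, a true literal or two literals
without a truth value. -/
theorem Saturated.exists_mem {c : List Literal} {F : List (List Literal)} {S : List Literal}
    (h : Saturated c F S) (hS : hasConflict c F S = false) {k : List Literal} (hk : k ∈ F)
    (hact : isActive c k = true) :
    (∃ l ∈ k, markOf c S l = .yes) ∨
      ∃ l ∈ k, ∃ l' ∈ k, l ≠ l' ∧ markOf c S l = .unset ∧ markOf c S l' = .unset := by
  by_cases hyes : ∃ l ∈ k, markOf c S l = .yes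
  · exact Or.inl hyes
  push Not at hyes
  rw [← Bool.not_eq_true, hasConflict_iff] at hS
  push Not at hS
  obtain ⟨l, hl, hlS⟩ := hS k hk hact
  have hu : markOf c S l = .unset := by
    by_contra hu
    exact hyes l hl (hlS hu)
  have hf := h l (List.mem_flatten.2 ⟨k, hk, hl⟩)
  rw [← Bool.not_eq_true, isForced_iff] at hf
  push Not at hf
  obtain ⟨l', hl', h'⟩ := hf k hk hact hl hu
  obtain ⟨h₁, h₂⟩ := h' (hyes l' hl')
  exact Or.inr ⟨l, hl, l', hl', h₂.symm, hu, h₁⟩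

/-! ### Models from propagation without conflict: Horn and Krom -/

/-- The assignment makes true only what `S` contains positively. A clause without a literal in `S`
that counts has two unset literals; one of them is negative, hence true. A single run without
conflict suffices, whatever its starting literal. -/
theorem exists_satisfiesActive_of_isHorn {c : List Literal} {F : List (List Literal)}
    {S : List Literal} (hF : IsHorn (clausesOf F)) (hsat : Saturated c F S) (hcon : Consistent S)
    (hS : hasConflict c F S = false) : ∃ v, SatisfiesActive c F v := by
  refine ⟨fun y => decide ((y, true) ∈ S), fun k hk hact => ?_⟩
  have hneg : ∀ l ∈ k, l.2 = false → markOf c S l = .unset →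
      ∃ l ∈ k, l ∉ c ∧ l.opp ∉ c ∧ decide ((l.1, true) ∈ S) = l.2 := by
    rintro ⟨y, b⟩ hl rfl hu
    obtain ⟨⟨h₁, h₂⟩, -, h₄⟩ := markOf_eq_unset.1 hu
    refine ⟨_, hl, h₁, h₂, ?_⟩
    simpa [Literal.opp] using h₄
  rcases hsat.exists_mem hS hk hact with ⟨⟨y, b⟩, hl, hyes⟩ | ⟨l, hl, l', hl', hne, hu, hu'⟩
  · obtain ⟨⟨h₁, h₂⟩, h₃⟩ := markOf_eq_yes.1 hyes
    refine ⟨_, hl, h₁, h₂, ?_⟩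
    cases b
    · simpa [Literal.opp] using hcon _ h₃
    · simpa using h₃
  · by_cases hb : l.2 = false
    · exact hneg l hl hb hu
    · by_cases hb' : l'.2 = false
      · exact hneg l' hl' hb' hu'
      · refine absurd (Finset.card_le_one.1 (hF.2 _ ⟨k, hk, rfl⟩) l ?_ l' ?_) hne
        · simpa [hl] using hb
        · simpa [hl'] using hb'

/-- A partial assignment that satisfies the used clauses, apart from those in which it gives no
literal a truth value. -/
def Autark (c : List Literal) (F : List (List Literal)) (α : Variable → Option Bool) : Prop :=
  ∀ k ∈ F, isActive c k = true → (∃ l ∈ k, l ∉ c ∧ l.opp ∉ c ∧ α l.1 = some l.2) ∨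
    ∀ l ∈ k, l ∉ c → l.opp ∉ c → α l.1 = none

/-- Where both have a value, `α` wins. A clause that `α` touches is satisfied by `α`; on the others
only `β` counts. -/
theorem Autark.or {c : List Literal} {F : List (List Literal)} {α β : Variable → Option Bool}
    (hα : Autark c F α) (hβ : Autark c F β) : Autark c F fun y => (α y).or (β y) := by
  intro k hk hact
  rcases hα k hk hact with ⟨l, hl, h₁, h₂, h⟩ | h
  · exact Or.inl ⟨l, hl, h₁, h₂, by simp [h]⟩
  · rcases hβ k hk hact with ⟨l, hl, h₁, h₂, h'⟩ | h'
    · exact Or.inl ⟨l, hl, h₁, h₂, by simp [h l hl h₁ h₂, h']⟩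
    · exact Or.inr fun l hl h₁ h₂ => by simp [h l hl h₁ h₂, h' l hl h₁ h₂]

/-- An active clause without a true literal has two unset literals, and by the Krom bound it has no
others: the assignment does not touch it. -/
theorem exists_autark_of_isKrom {c : List Literal} {F : List (List Literal)}
    {S : List Literal} (hF : IsKrom (clausesOf F)) (hsat : Saturated c F S) (hcon : Consistent S)
    (hS : hasConflict c F S = false) :
    ∃ α, Autark c F α ∧ ∀ l ∈ S, α l.1 ≠ none := by
  let α : Variable → Option Bool := fun y =>
    if (y, true) ∈ S then some true else if (y, false) ∈ S then some false else none
  have hα : ∀ l ∈ S, α l.1 = some l.2 := by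
    rintro ⟨y, b⟩ hl
    have := hcon _ hl
    cases b
    · simp only [Literal.opp, Bool.not_false] at this
      simp [α, hl, this]
    · simp [α, hl]
  have hα' : ∀ l : Literal, l ∉ S → l.opp ∉ S → α l.1 = none := by
    rintro ⟨y, b⟩ h₁ h₂
    cases b <;> simp only [Literal.opp, Bool.not_false, Bool.not_true] at h₂ <;> simp [α, h₁, h₂]
  refine ⟨α, fun k hk hact => ?_, fun l hl => by simp [hα l hl]⟩
  rcases hsat.exists_mem hS hk hact with ⟨l, hl, hyes⟩ | ⟨l, hl, l', hl', hne, hu, hu'⟩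
  · obtain ⟨⟨h₁, h₂⟩, h₃⟩ := markOf_eq_yes.1 hyes
    exact Or.inl ⟨l, hl, h₁, h₂, hα l h₃⟩
  · right
    intro m hm _ _
    have hmem : m = l ∨ m = l' := by
      by_contra hml
      push Not at hml
      have h₁ : ({m, l, l'} : Finset Literal).card = 3 :=
        Finset.card_eq_three.2 ⟨m, l, l', hml.1, hml.2, hne, rfl⟩
      have h₂ : ({m, l, l'} : Finset Literal) ⊆ k.toFinset := by
        intro z hz
        simp only [Finset.mem_insert, Finset.mem_singleton] at hz
        rcases hz with rfl | rfl | rfl <;> simpa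
      have h₃ := Finset.card_le_card h₂
      have h₄ := hF.2 _ ⟨k, hk, rfl⟩
      omega
    rcases hmem with rfl | rfl
    · obtain ⟨-, h₁, h₂⟩ := markOf_eq_unset.1 hu
      exact hα' _ h₁ h₂
    · obtain ⟨-, h₁, h₂⟩ := markOf_eq_unset.1 hu'
      exact hα' _ h₁ h₂

theorem mem_propagateAll (c : List Literal) (F : List (List Literal)) (x : Literal) :
    x ∈ propagateAll c F [x] := by
  refine propagateAll_induction (p := fun S => x ∈ S) (by simp) fun S m h => ?_
  unfold propagateStep
  split_ifs
  · exact List.mem_cons_of_mem _ h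
  · exact h

/-- Each variable of `F` is assigned by some run without conflict; the overlay of these autarkies
assigns them all, so that every active clause with a live literal is touched and thus satisfied. -/
theorem exists_satisfiesActive_of_isKrom {c : List Literal} {F : List (List Literal)}
    (hF : IsKrom (clausesOf F)) (h : ∀ x ∈ F.flatten, isRefuted c F x = false)
    {x : Literal} (hx : x ∈ F.flatten) : ∃ v, SatisfiesActive c F v := by
  have h₀ : ∀ x ∈ F.flatten, ∃ x', x'.1 = x.1 ∧
      hasConflict c F (propagateAll c F [x']) = false := by
    intro x hx
    have := h x hx
    rw [isRefuted, Bool.and_eq_false_iff] at this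
    rcases this with h | h
    · exact ⟨x, rfl, h⟩
    · exact ⟨x.opp, rfl, h⟩
  have h₁ : ∀ V : List Literal, V ⊆ F.flatten → ∃ α, Autark c F α ∧ ∀ l ∈ V, α l.1 ≠ none := by
    intro V
    induction V with
    | nil => exact fun _ => ⟨fun _ => none, fun k _ _ => Or.inr fun _ _ _ _ => rfl, by simp⟩
    | cons y V ih =>
      intro hV
      obtain ⟨α, hα, hαV⟩ := ih fun l hl => hV (List.mem_cons_of_mem _ hl)
      obtain ⟨y', hy', hcon⟩ := h₀ y (hV List.mem_cons_self)
      obtain ⟨β, hβ, hβS⟩ := exists_autark_of_isKrom hF (saturated_propagateAll c F y')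
        (consistent_propagateAll c F y') hcon
      refine ⟨_, hα.or hβ, fun l hl => ?_⟩
      rcases List.mem_cons.1 hl with rfl | hl
      · have := hβS y' (mem_propagateAll c F y')
        rw [hy'] at this
        simp [this]
      · simp [hαV l hl]
  obtain ⟨α, hα, hαV⟩ := h₁ _ (List.Subset.refl _)
  refine ⟨fun y => (α y).getD false, fun k hk hact => ?_⟩
  rcases hα k hk hact with ⟨l, hl, h₁, h₂, h₃⟩ | h'
  · exact ⟨l, hl, h₁, h₂, by simp [h₃]⟩
  -- An untouched active clause would have dead literals only, and such a clause is a conflict in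
  -- every run. The literal `x` provides a run without conflict.
  · obtain ⟨x', -, hcon⟩ := h₀ x hx
    rw [← Bool.not_eq_true, hasConflict_iff] at hcon
    refine absurd ⟨k, hk, hact, fun l hl => ?_⟩ hcon
    have hdead : l ∈ c ∨ l.opp ∈ c := by
      by_contra hd
      rw [not_or] at hd
      exact hαV l (List.mem_flatten.2 ⟨k, hk, hl⟩) (h' l hl hd.1 hd.2)
    rw [markOf_eq_dead.2 hdead]
    simp

/-! ### Correctness and the main theorem -/

/-- The algorithm is correct. -/
theorem any_isRefuted_iff {F : List (List Literal)} {c : List Literal}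
    (hF : IsHorn (clausesOf F) ∨ IsKrom (clausesOf F)) (hc : c.toFinset ∈ clausesOf F) :
    F.flatten.any (isRefuted c F) = true ↔ Superredundant (clausesOf F) c.toFinset := by
  have hFt : TautologyFree (clausesOf F) := hF.elim (fun h => h.1) fun h => h.1
  rw [superredundant_iff_active hFt hc]
  constructor
  · rintro h ⟨v, hv⟩
    obtain ⟨m, -, hm⟩ := List.any_eq_true.1 h
    rw [isRefuted_eq_false hv] at hm
    exact absurd hm (by simp)
  · intro h
    by_contra hany
    rw [Bool.not_eq_true, List.any_eq_false] at hany
    refine h ?_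
    -- Without any literal no run is started and the answer is no. This is right: all clauses, and
    -- `c`, are empty, and none is active.
    rcases hV : F.flatten with _ | ⟨x, V⟩
    · have hnil : ∀ k ∈ F, k = [] := by
        intro k hk
        rw [List.eq_nil_iff_forall_not_mem]
        intro l hl
        have : l ∈ F.flatten := List.mem_flatten.2 ⟨k, hk, hl⟩
        simp [hV] at this
      obtain ⟨k, hk, hkc⟩ := hc
      rw [hnil k hk, List.toFinset_nil] at hkc
      have hc' : c = [] := by simpa using hkc.symm
      refine ⟨fun _ => false, fun k hk hact => ?_⟩
      rw [hnil k hk, hc', isActive_iff] at hact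
      simp at hact
    · have hx : x ∈ F.flatten := by simp [hV]
      rcases hF with hF | hF
      · have := hany x hx
        rw [Bool.not_eq_true, isRefuted, Bool.and_eq_false_iff] at this
        rcases this with h | h
        · exact exists_satisfiesActive_of_isHorn hF (saturated_propagateAll c F x)
            (consistent_propagateAll c F x) h
        · exact exists_satisfiesActive_of_isHorn hF (saturated_propagateAll c F x.opp)
            (consistent_propagateAll c F x.opp) h
      · exact exists_satisfiesActive_of_isKrom hF (fun x hx => by simpa using hany x hx) hx

theorem clausesOf_reverse (F : List (List Literal)) :
    clausesOf (F.map List.reverse).reverse = clausesOf F := by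
  ext c
  simp only [clausesOf, List.mem_reverse, List.mem_map, Set.mem_ofPred_eq]
  constructor
  · rintro ⟨_, ⟨k, hk, rfl⟩, rfl⟩
    exact ⟨k, hk, by simp⟩
  · rintro ⟨k, hk, rfl⟩
    exact ⟨k.reverse, ⟨k, hk, rfl⟩, by simp⟩

end StackProgram

open StackProgram in
/-- Superredundancy can be checked in polynomial time in classes of Horn and Krom formulae. -/
theorem superredundancyInPolyTime {C : Set Clause → Prop} (hC : ∀ F, C F → IsHorn F ∨ IsKrom F) :
    SuperredundancyInPolyTime C := by
  refine ⟨fun a => (a.formula.map List.reverse).reverse.flatten.any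
    (isRefuted a.clause (a.formula.map List.reverse).reverse), fun a => ?_, ?_⟩
  · have h := any_isRefuted_iff (F := (a.formula.map List.reverse).reverse) (c := a.clause)
      (by rw [clausesOf_reverse]; exact hC _ a.formula_mem)
      (by rw [clausesOf_reverse]; exact a.clause_mem)
    rwa [clausesOf_reverse] at h
  · refine nonempty_computableInPolyTime_of_implements checkSuperredundancy checkTime
      (fun c F => checkItems c F.flatten)
      (fun c F n hc hF => implements_checkSuperredundancy hc hF) fun a => ?_
    -- The clause is reversed once by being pushed on a stack and once more by the accumulation of
    -- its literals in `foldl_prepare`.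
    rw [checkItems_ans, List.reverse_reverse]
    intro l hl hl'
    refine (hC _ a.formula_mem).elim (fun h => h.1) (fun h => h.1) _ a.clause_mem ⟨l, ?_, ?_⟩
    · simpa using hl
    · simpa using hl'

end Superredundancy

theorem mainTheorem10 :
    (Superredundancy.SuperredundancyInPolyTime Superredundancy.IsHorn ∧
      Superredundancy.SuperredundancyInPolyTime Superredundancy.IsKrom) ∧
    (∀ (F : Set Superredundancy.Clause) (c : Superredundancy.Clause),
      Superredundancy.IsHorn F ∨ Superredundancy.IsKrom F → c ∈ F →
        (Superredundancy.Superredundant F c ↔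
          Superredundancy.Entails ((F \ {c}) ∪ Superredundancy.resolve F {c}) c)) ∧
    (∀ F : Set Superredundancy.Clause,
      Superredundancy.IsHorn F → Superredundancy.IsHorn (Superredundancy.ResCn F)) ∧
    (∀ F : Set Superredundancy.Clause,
      Superredundancy.IsKrom F → Superredundancy.IsKrom (Superredundancy.ResCn F)) :=
  ⟨⟨Superredundancy.superredundancyInPolyTime fun _ h => Or.inl h,
    Superredundancy.superredundancyInPolyTime fun _ h => Or.inr h⟩,
    fun _ _ hF hc => Superredundancy.superredundant_iff (hF.elim (fun h => h.1) fun h => h.1) hc,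
    fun _ h => h.resCn, fun _ h => h.resCn⟩
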